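/- Let $V$ be a finite set, $\mathcal I=\prod_{\gamma\in V}\mathcal I_\gamma$ a product of finite sets and $i^*\in\mathcal I$ a fixed cell. For $E\subseteq V$ write $i_E$ for elements of $\mathcal I_E=\prod_{\gamma\in E}\mathcal I_\gamma$ and put $\mathcal I_E^*=\{i_E: i_\gamma\neq i^*_\gamma\ \forall\gamma\in E\}$. For a probability vector $p$ on $\mathcal I$ let $p^A$ be its $A$-marginal ($A\subseteq V$), let $p^A(i_D,i^*_{D^c})$, for $D\subseteq A$, be the probability of the $A$-marginal cell equal to $i_D$ on $D$ and to $i^*$ on $D^c=A\setminus D$, and let $p^A_\emptyset=p^A(i^*_A)$. Let $G$ be a decomposable graph on $V$, with a perfect sequence $C_1,\dots,C_k$ of its cliques (an enumeration without repetition of the maximal complete sets such that for each $l\ge 2$ the separator $S_l=C_l\cap\bigcup_{j<l}C_j$ is contained in some $C_j$, $j<l$). Let $\mathcal D$ be the class of nonempty complete subsets of $V$, and $\mathcal D^{A}=\{D\in\mathcal D: D\subseteq A\}$. The graphical model of $G$ is the set of strictly positive probability vectors $p$ on $\mathcal I$ such that the log-linear parameters $$\theta_E(i_E)=\sum_{F\subseteq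 E}(-1)^{|E\setminus F|}\log p(i_F,i^*_{F^c})$$ vanish for all nonempty $E\notin\mathcal D$ and all $i_E\in\mathcal I_E^*$. Write $\theta_{\mathcal D}=(\theta_D(i_D))_{D\in\mathcal D,\,i_D\in\mathcal I_D^*}$. For every $D\in\mathcal D$ choose a block $A_D\supseteq D$: one of the separators $S_l$ containing $D$ if there is any, and otherwise the clique containing $D$, which is then unique. Let $$p^G=\bigl(p^{A_D}(i_D,i^*_{D^c})\bigr)_{D\in\mathcal D,\ i_D\in\mathcal I_D^*}.$$ Then $p\mapsto\theta_{\mathcal D}$ is a bijection from the model onto the space $\mathbb R^{d}$ of all real vectors indexed by the pairs $(D,i_D)$, $D\in\mathcal D$, $i_D\in\mathcal I_D^*$, with inverse $$p(i)=\frac{w_\theta(i)}{\sum_{j\in\mathcal I}w_\theta(j)},\qquad w_\theta(i)=\exp\sum_{D\in\mathcal D:\ i_D\in\mathcal I_D^*}\theta_D(i_D).$$ Moreover $\theta_{\mathcal D}\mapsto p^G$ is a smooth change of variables: it is an injective $C^\infty$ map from $\mathbb R^d$ onto an open subset of $\mathbb R^{d}$, with $C^\infty$ inverse. Its Jacobian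 is given at every $\theta_{\mathcal D}\in\mathbb R^d$ by $$\left|\frac{d\theta_{\mathcal D}}{dp^G}\right|^{-1}=\left|\frac{dp^G}{d\theta_{\mathcal D}}\right|=\frac{\prod_{l=1}^k p_\emptyset^{C_l}\prod_{D\in\mathcal D^{C_l}}\prod_{i_D\in\mathcal I_D^*}p^{C_l}(i_D,i^*_{D^c})}{\prod_{l=2}^k p_\emptyset^{S_l}\prod_{D\in\mathcal D^{S_l}}\prod_{i_D\in\mathcal I_D^*}p^{S_l}(i_D,i^*_{D^c})},$$ where $|\cdot|$ denotes the absolute value of the determinant. -/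

import Mathlib

open scoped ContDiff

namespace LogLinear

section

variable {V : Type*} [Fintype V] [DecidableEq V]

/-- The `l`-th separator `C_l ∩ ⋃_{j < l} C_j` of a sequence `C_0, …, C_m` of vertex sets
(numbered from `0`, so that the separators belong to the indices `1, …, m`). -/
def separator {m : ℕ} (C : Fin (m + 1) → Finset V) (l : Fin m) : Finset V :=
  C l.succ ∩ (Finset.univ.filter fun j => j ≤ l.castSucc).biUnion C

/-- `C_0, …, C_m` is a perfect sequence of the cliques (maximal complete vertex sets) of `G`:
it enumerates them without repetition and has the running intersection property. The graph `G`
is decomposable if and only if it has such a sequence. -/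
structure IsPerfectCliqueSequence (G : SimpleGraph V) {m : ℕ} (C : Fin (m + 1) → Finset V) :
    Prop where
  injective : Function.Injective C
  mem_range_iff : ∀ K : Finset V,
    K ∈ Set.range C ↔ Maximal (fun L : Finset V => G.IsClique (L : Set V)) K
  running_intersection : ∀ l : Fin m, ∃ j : Fin (m + 1), j ≤ l.castSucc ∧ separator C l ⊆ C j

/-- The class `𝒟` of nonempty complete vertex sets. -/
def CompleteSet (G : SimpleGraph V) : Type _ :=
  {D : Finset V // D.Nonempty ∧ G.IsClique (D : Set V)}

variable {I : V → Type*} [∀ γ, Fintype (I γ)] [∀ γ, DecidableEq (I γ)]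

/-- The set `I_E^*` of `E`-marginal cells none of whose components is at the baseline level. -/
def StarCell (i0 : ∀ γ, I γ) (E : Finset V) : Type _ :=
  {x : ∀ γ : E, I γ // ∀ γ : E, x γ ≠ i0 γ}

/-- The index set of the free parameters: pairs `(D, i_D)` with `D ∈ 𝒟` and `i_D ∈ I_D^*`. -/
def ParamIndex (G : SimpleGraph V) (i0 : ∀ γ, I γ) : Type _ :=
  Σ D : CompleteSet G, StarCell i0 D.1

instance (G : SimpleGraph V) : Finite (CompleteSet G) :=
  inferInstanceAs (Finite {D : Finset V // D.Nonempty ∧ G.IsClique (D : Set V)})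

instance (i0 : ∀ γ, I γ) (E : Finset V) : Finite (StarCell i0 E) :=
  inferInstanceAs (Finite {x : ∀ γ : E, I γ // ∀ γ : E, x γ ≠ i0 γ})

instance (G : SimpleGraph V) (i0 : ∀ γ, I γ) : Finite (ParamIndex G i0) :=
  inferInstanceAs (Finite (Σ D : CompleteSet G, StarCell i0 D.1))

noncomputable instance (G : SimpleGraph V) (i0 : ∀ γ, I γ) : Fintype (ParamIndex G i0) :=
  Fintype.ofFinite _

/-- The vertex set `D` of an index `(D, i_D)`. -/
def ParamIndex.set {G : SimpleGraph V} {i0 : ∀ γ, I γ} (t : ParamIndex G i0) : Finset V :=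
  t.1.1

/-- The marginal cell `i_D` of an index `(D, i_D)`. -/
def ParamIndex.cell {G : SimpleGraph V} {i0 : ∀ γ, I γ} (t : ParamIndex G i0) :
    ∀ γ : t.set, I γ :=
  t.2.1

/-- The full cell `(i_E, i_{E^c}^*)` obtained from an `E`-marginal cell by putting all other
components at the baseline level. -/
def extend (i0 : ∀ γ, I γ) {E : Finset V} (x : ∀ γ : E, I γ) : ∀ γ, I γ :=
  fun γ => if h : γ ∈ E then x ⟨γ, h⟩ else i0 γ

/-- The log-linear parameter
`θ_E(i_E) = ∑_{F ⊆ E} (-1)^{|E \ F|} log p(i_F, i_{F^c}^*)`. -/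
noncomputable def logLinear (i0 : ∀ γ, I γ) (p : (∀ γ, I γ) → ℝ) (E : Finset V)
    (x : ∀ γ : E, I γ) : ℝ :=
  ∑ F ∈ E.powerset, (-1 : ℝ) ^ (E \ F).card * Real.log (p (F.piecewise (extend i0 x) i0))

/-- The graphical log-linear model of `G`: the strictly positive probability vectors `p` with
`θ_E(i_E) = 0` for all nonempty `E` that are not complete and all `i_E ∈ I_E^*`. -/
def model (G : SimpleGraph V) (i0 : ∀ γ, I γ) : Set ((∀ γ, I γ) → ℝ) :=
  {p | (∀ i, 0 < p i) ∧ ∑ i, p i = 1 ∧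
    ∀ E : Finset V, E.Nonempty → ¬ G.IsClique (E : Set V) →
      ∀ x : StarCell i0 E, logLinear i0 p E x.1 = 0}

/-- The parameter vector `θ_𝒟 = (θ(i_D), D ∈ 𝒟, i_D ∈ I_D^*)` of `p`. -/
noncomputable def thetaD (G : SimpleGraph V) (i0 : ∀ γ, I γ) (p : (∀ γ, I γ) → ℝ) :
    ParamIndex G i0 → ℝ :=
  fun t => logLinear i0 p t.set t.cell

/-- `exp (∑_F θ(i_F))` for a full cell `i`, the sum being over the `F ∈ 𝒟` such that no component
of `i_F` is at the baseline level. For `i = (i_E, i_{E^c}^*)` with `i_E ∈ I_E^*` these are the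
`F ∈ 𝒟` with `F ⊆ E`. -/
noncomputable def weight (G : SimpleGraph V) (i0 : ∀ γ, I γ) (θ : ParamIndex G i0 → ℝ)
    (i : ∀ γ, I γ) : ℝ :=
  Real.exp (∑ t : ParamIndex G i0 with t.set.restrict i = t.cell, θ t)

/-- The cell probabilities of the model as functions of `θ_𝒟`. -/
noncomputable def cellProb (G : SimpleGraph V) (i0 : ∀ γ, I γ) (θ : ParamIndex G i0 → ℝ) :
    (∀ γ, I γ) → ℝ :=
  fun i => weight G i0 θ i / ∑ j, weight G i0 θ j

/-- The `A`-marginal probability `p^A(i_A) = ∑_{j : j_A = i_A} p(j)`. -/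
noncomputable def marginal (p : (∀ γ, I γ) → ℝ) (A : Finset V) (y : ∀ γ : A, I γ) : ℝ :=
  ∑ j : (∀ γ, I γ) with A.restrict j = y, p j

/-- The marginal probability `p^A(i_D, i_{D^c}^*)` for an index `(D, i_D)` with `D ⊆ A`, where
`D^c` is the complement of `D` in `A`. -/
noncomputable def marginalAt {G : SimpleGraph V} {i0 : ∀ γ, I γ} (p : (∀ γ, I γ) → ℝ)
    (A : Finset V) (t : ParamIndex G i0) : ℝ :=
  marginal p A (A.restrict (extend i0 t.cell))

/-- The product `p_∅^A ∏_{D ∈ 𝒟^A} ∏_{i_D ∈ I_D^*} p^A(i_D, i_{D^c}^*)`, where `𝒟^A` is the class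
of nonempty complete subsets of `A`. -/
noncomputable def blockProd (G : SimpleGraph V) (i0 : ∀ γ, I γ) (p : (∀ γ, I γ) → ℝ)
    (A : Finset V) : ℝ :=
  marginal p A (A.restrict i0) * ∏ t : ParamIndex G i0 with t.set ⊆ A, marginalAt p A t

/-- A choice, for each `D ∈ 𝒟`, of the block from whose marginal table the free probabilities
with index `D` are taken: a separator containing `D` if there is one, and otherwise the clique
containing `D`. -/
def IsBlockChoice (G : SimpleGraph V) {m : ℕ} (C : Fin (m + 1) → Finset V)
    (A : Finset V → Finset V) : Prop :=
  ∀ D : Finset V, D.Nonempty → G.IsClique (D : Set V) →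
    D ⊆ A D ∧
      ((∃ l, D ⊆ separator C l) → A D ∈ Set.range (separator C)) ∧
      ((¬ ∃ l, D ⊆ separator C l) → A D ∈ Set.range C)

/-- The vector `p^G` of free marginal clique and separator probabilities as a function of the
cell probabilities. -/
noncomputable def pG (G : SimpleGraph V) (i0 : ∀ γ, I γ) (A : Finset V → Finset V)
    (p : (∀ γ, I γ) → ℝ) : ParamIndex G i0 → ℝ :=
  fun t => marginalAt p (A t.set) t

/-- The change of variables `θ_𝒟 ↦ p^G`. -/
noncomputable def changeOfVar (G : SimpleGraph V) (i0 : ∀ γ, I γ) (A : Finset V → Finset V) :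
    (ParamIndex G i0 → ℝ) → (ParamIndex G i0 → ℝ) :=
  fun θ => pG G i0 A (cellProb G i0 θ)

/-- The ratio of the product over the cliques to the product over the separators. -/
noncomputable def jacobianRatio (G : SimpleGraph V) (i0 : ∀ γ, I γ) {m : ℕ}
    (C : Fin (m + 1) → Finset V) (p : (∀ γ, I γ) → ℝ) : ℝ :=
  (∏ l, blockProd G i0 p (C l)) / ∏ l, blockProd G i0 p (separator C l)

end

end LogLinear

set_option linter.unusedSectionVars false

/-! The model is an exponential family: up to an additive constant, `log p` is the combination with
coefficients `θ_D(i_D)` of the indicators of the events `i_D`. Möbius inversion over supports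
recovers the coefficients from `log p`, which gives the parametrization (`thetaD_cellProb`,
`cellProb_thetaD`).

The derivative of the mean parameters in `θ` is the covariance matrix of these indicators
(`hasFDerivAt_mean`). Inside complete blocks, inclusion-exclusion turns the means into `p^G` by a
unitriangular linear map (`exists_changeOfVar_eq_mulVec`). Hence the Jacobian is `det (cov θ)`.

Bordering by the constant statistic turns this into a second-moment determinant indexed by all cells
with complete support (`det_cov`). For the cells supported in a single set `A`, the matrix is `Z *
diagonal * Zᵀ` with `Z` unitriangular and the `A`-marginal probabilities on the diagonal, so its
determinant is their product (`det_gram_cellsIn`). When a clique is attached to the earlier ones,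
conditional independence makes the conditional means of its indicators, given the past, combinations
of separator indicators. The Schur complement is therefore the same over the whole past as over the
separator, and the determinant gains the factor clique product over separator product
(`gramDet_mul_gramDet`). Induction along the perfect sequence gives the formula
(`gramDet_cellsUpTo`).

Injectivity comes from a symmetrized Kullback–Leibler divergence (`mean_injective`). As the Jacobian
is positive, the inverse function theorem yields the open image and the smooth inverse. -/

namespace LogLinear

open Finset

/-! ### Cells, their supports and indicators; the moment determinant of one block -/

section Cells

variable {V : Type*} [Fintype V] {I : V → Type*} [∀ γ, DecidableEq (I γ)]

/-- The set of vertices at which a cell is not at the baseline level. -/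
def supp (i0 c : ∀ γ, I γ) : Finset V := univ.filter fun γ => c γ ≠ i0 γ

/-- The indicator function of the cells that agree with `c` on `A`. -/
def ind (A : Finset V) (c i : ∀ γ, I γ) : ℝ := if ∀ γ ∈ A, i γ = c γ then 1 else 0

variable (i0 : ∀ γ, I γ)

@[simp] lemma mem_supp {c : ∀ γ, I γ} {γ : V} : γ ∈ supp i0 c ↔ c γ ≠ i0 γ := by simp [supp]

lemma eq_of_notMem_supp {c : ∀ γ, I γ} {γ : V} (h : γ ∉ supp i0 c) : c γ = i0 γ := by
  simpa using h

variable [DecidableEq V]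

@[simp] lemma supp_self : supp i0 i0 = ∅ := by ext; simp

lemma supp_eq_empty {c : ∀ γ, I γ} : supp i0 c = ∅ ↔ c = i0 := by
  constructor
  · intro h
    funext γ
    exact eq_of_notMem_supp i0 (by simp [h])
  · rintro rfl
    exact supp_self _

lemma supp_piecewise (A : Finset V) (i : ∀ γ, I γ) :
    supp i0 (A.piecewise i i0) = A ∩ supp i0 i := by
  ext γ
  by_cases h : γ ∈ A <;> simp [h]

lemma piecewise_eq_self {A : Finset V} {d : ∀ γ, I γ} (hd : supp i0 d ⊆ A) :
    A.piecewise d i0 = d := by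
  funext γ
  by_cases h : γ ∈ A
  · simp [h]
  · simp [h, eq_of_notMem_supp i0 (fun h' => h (hd h'))]

lemma ind_congr {A : Finset V} (c : ∀ γ, I γ) {i j : ∀ γ, I γ} (h : ∀ γ ∈ A, i γ = j γ) :
    ind A c i = ind A c j := by
  unfold ind
  congr 1
  exact propext (forall₂_congr fun γ hγ => by rw [h γ hγ])

@[simp] lemma ind_empty (c i : ∀ γ, I γ) : ind ∅ c i = 1 := by simp [ind]

lemma ind_self (A : Finset V) (c : ∀ γ, I γ) : ind A c c = 1 := by simp [ind]

lemma ind_eq_ite_piecewise {A : Finset V} {d : ∀ γ, I γ} (hd : supp i0 d ⊆ A) (i : ∀ γ, I γ) :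
    ind A d i = if A.piecewise i i0 = d then 1 else 0 := by
  unfold ind
  congr 1
  refine propext ⟨fun h => ?_, fun h γ hγ => ?_⟩
  · rw [← piecewise_eq_self i0 hd]
    funext γ
    by_cases hγ : γ ∈ A
    · simp [hγ, h γ hγ]
    · simp [hγ]
  · rw [← h]; simp [hγ]

variable [∀ γ, Fintype (I γ)]

/-- The cells whose support is contained in `A`; they represent the cells of the `A`-marginal
table. -/
def cellsIn (A : Finset V) : Finset (∀ γ, I γ) := univ.filter fun c => supp i0 c ⊆ A

@[simp] lemma mem_cellsIn {A : Finset V} {c : ∀ γ, I γ} :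
    c ∈ cellsIn i0 A ↔ supp i0 c ⊆ A := by simp [cellsIn]

/-- The events indexed by `cellsIn i0 A` partition the table, and `i` lies in the one named by its
truncation to `A`. -/
lemma sum_mul_ind (A : Finset V) (f : (∀ γ, I γ) → ℝ) (i : ∀ γ, I γ) :
    ∑ d ∈ cellsIn i0 A, f d * ind A d i = f (A.piecewise i i0) := by
  rw [sum_eq_single (A.piecewise i i0)]
  · rw [ind_eq_ite_piecewise i0 (by rw [supp_piecewise]; exact inter_subset_left)]
    simp
  · intro d hd hne
    rw [ind_eq_ite_piecewise i0 (by simpa using hd), if_neg (Ne.symm hne), mul_zero]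
  · intro h
    exact absurd (by rw [mem_cellsIn, supp_piecewise]; exact inter_subset_left) h

lemma sum_ind_mul_ind {A B : Finset V} (hB : B ⊆ A) (c i : ∀ γ, I γ) :
    ∑ d ∈ cellsIn i0 A, ind B c d * ind A d i = ind B c i := by
  rw [sum_mul_ind]
  exact ind_congr c fun γ hγ => by simp [hB hγ]

/-- Source of all the unitriangularity: if `d` agrees with `c` on the support of `c`, then its
support is at least as large, and equal size forces `d = c`. -/
lemma eq_of_ind_ne_zero {c d : ∀ γ, I γ} (h : ind (supp i0 c) c d ≠ 0)
    (hcard : (supp i0 d).card ≤ (supp i0 c).card) : c = d := by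
  have h1 : ∀ γ ∈ supp i0 c, d γ = c γ := by
    by_contra hn
    exact h (by simp only [ind, if_neg hn])
  have h2 : supp i0 c ⊆ supp i0 d := fun γ hγ => by
    have := h1 γ hγ
    simp only [mem_supp] at hγ ⊢
    rwa [this]
  have h3 := eq_of_subset_of_card_le h2 hcard
  funext γ
  by_cases hγ : γ ∈ supp i0 c
  · exact (h1 γ hγ).symm
  · have h4 : γ ∉ supp i0 d := h3 ▸ hγ
    rw [eq_of_notMem_supp i0 hγ, eq_of_notMem_supp i0 h4]

/-- The indicator of an `A`-marginal cell is a combination of the indicators of the cells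
`c_{supp c}`, unitriangular with respect to inclusion of supports. -/
lemma exists_ind_eq (A : Finset V) (c : ∀ γ, I γ) (hc : supp i0 c ⊆ A) :
    ∃ u : (∀ γ, I γ) → ℝ, u c = 1 ∧
      (∀ d, u d ≠ 0 → supp i0 d ⊆ A ∧ (d = c ∨ (supp i0 c).card < (supp i0 d).card)) ∧
      ∀ i, ind A c i = ∑ d, u d * ind (supp i0 d) d i := by
  -- Induction from large supports to small: the event of `c` on its own support splits into
  -- `A`-cells, namely `c` and cells `d` with strictly larger support, to which the hypothesis
  -- applies.
  induction hn : A.card - (supp i0 c).card using Nat.strong_induction_on generalizing c with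
  | _ n ih =>
    have key : ∀ d : ∀ γ, I γ, ∃ v : (∀ γ, I γ) → ℝ,
        (d ∈ (cellsIn i0 A).erase c → ind (supp i0 c) c d ≠ 0 →
          (∀ e, v e ≠ 0 → supp i0 e ⊆ A ∧ (supp i0 c).card < (supp i0 e).card) ∧
          ∀ i, ind A d i = ∑ e, v e * ind (supp i0 e) e i) := by
      intro d
      by_cases hd : d ∈ (cellsIn i0 A).erase c ∧ ind (supp i0 c) c d ≠ 0
      · obtain ⟨hd, h0⟩ := hd
        rw [mem_erase, mem_cellsIn] at hd
        have hlt : (supp i0 c).card < (supp i0 d).card := by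
          by_contra hle
          exact hd.1 (eq_of_ind_ne_zero i0 h0 (not_lt.1 hle)).symm
        have := card_le_card hd.2
        obtain ⟨v, -, hv, hv'⟩ := ih (A.card - (supp i0 d).card) (by omega) d hd.2 rfl
        refine ⟨v, fun _ _ => ⟨fun e he => ⟨(hv e he).1, ?_⟩, hv'⟩⟩
        rcases (hv e he).2 with rfl | h
        · exact hlt
        · omega
      · exact ⟨0, fun h1 h2 => absurd ⟨h1, h2⟩ hd⟩
    choose v hv using key
    have hzero : ∀ e, (∑ d ∈ (cellsIn i0 A).erase c, ind (supp i0 c) c d * v d e) ≠ 0 →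
        supp i0 e ⊆ A ∧ (supp i0 c).card < (supp i0 e).card := by
      intro e he
      obtain ⟨d, hd, h⟩ := exists_ne_zero_of_sum_ne_zero he
      exact (hv d hd (left_ne_zero_of_mul h)).1 e (right_ne_zero_of_mul h)
    refine ⟨fun e => (if e = c then 1 else 0) -
      ∑ d ∈ (cellsIn i0 A).erase c, ind (supp i0 c) c d * v d e, ?_, ?_, ?_⟩
    · have : (∑ d ∈ (cellsIn i0 A).erase c, ind (supp i0 c) c d * v d c) = 0 := by
        by_contra h
        exact lt_irrefl _ (hzero c h).2
      simp [this]
    · intro e he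
      by_cases hec : e = c
      · subst hec; exact ⟨hc, Or.inl rfl⟩
      · simp only [if_neg hec, zero_sub, ne_eq, neg_eq_zero] at he
        exact ⟨(hzero e he).1, Or.inr (hzero e he).2⟩
    · intro i
      -- Isolating the term `d = c` in this splitting expresses `ind A c` through the other terms.
      have h1 := sum_ind_mul_ind i0 hc c i
      rw [← add_sum_erase _ _ ((mem_cellsIn i0).2 hc), ind_self, one_mul] at h1
      have h2 : ∑ d ∈ (cellsIn i0 A).erase c, ind (supp i0 c) c d * ind A d i =
          ∑ e, (∑ d ∈ (cellsIn i0 A).erase c, ind (supp i0 c) c d * v d e) *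
            ind (supp i0 e) e i := by
        simp_rw [sum_mul]
        rw [sum_comm]
        refine sum_congr rfl fun d hd => ?_
        by_cases h0 : ind (supp i0 c) c d = 0
        · simp [h0]
        · rw [(hv d hd h0).2 i, mul_sum]
          exact sum_congr rfl fun e _ => by ring
      simp only [sub_mul, sum_sub_distrib, ite_mul, one_mul, zero_mul, sum_ite_eq', mem_univ,
        if_true]
      rw [← h2]
      linarith

/-- A function of `i_A` is a combination of the indicators of the cells with support in `A`. -/
lemma exists_eq_sum_of_dependsOn (A : Finset V) (r : (∀ γ, I γ) → ℝ)
    (hr : DependsOn r (A : Set V)) :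
    ∃ u : (∀ γ, I γ) → ℝ, ∀ i, r i = ∑ d ∈ cellsIn i0 A, u d * ind (supp i0 d) d i := by
  have key : ∀ c : ∀ γ, I γ, ∃ u : (∀ γ, I γ) → ℝ, c ∈ cellsIn i0 A →
      ∀ i, ind A c i = ∑ d ∈ cellsIn i0 A, u d * ind (supp i0 d) d i := by
    intro c
    by_cases hc : c ∈ cellsIn i0 A
    · obtain ⟨u, -, hu, hu'⟩ := exists_ind_eq i0 A c (by simpa using hc)
      refine ⟨u, fun _ i => ?_⟩
      rw [hu' i]
      symm
      refine sum_subset (subset_univ _) fun d _ hd => ?_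
      have : u d = 0 := by
        by_contra h
        exact hd ((mem_cellsIn i0).2 (hu d h).1)
      simp [this]
    · exact ⟨0, fun h => absurd h hc⟩
  choose u hu using key
  refine ⟨fun d => ∑ c ∈ cellsIn i0 A, r c * u c d, fun i => ?_⟩
  have h1 : r i = r (A.piecewise i i0) := hr fun γ hγ => by
    have : γ ∈ A := hγ
    simp [this]
  rw [h1, ← sum_mul_ind i0 A r]
  simp_rw [sum_mul]
  rw [sum_comm]
  refine sum_congr rfl fun c hc => ?_
  rw [hu c hc i, mul_sum]
  exact sum_congr rfl fun e _ => by ring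

/-- The matrix of second moments of the indicators of the cells `c_{supp c}` under the measure
with density `w`. -/
def gram (w : (∀ γ, I γ) → ℝ) : Matrix (∀ γ, I γ) (∀ γ, I γ) ℝ :=
  fun s t => ∑ i, w i * (ind (supp i0 s) s i * ind (supp i0 t) t i)

/-- The product of the probabilities of the `A`-marginal cells. -/
def cellProd (w : (∀ γ, I γ) → ℝ) (A : Finset V) : ℝ :=
  ∏ c ∈ cellsIn i0 A, ∑ i, w i * ind A c i

/-- The determinant of a square matrix that is unitriangular with respect to a grading. -/
lemma det_eq_one_of_graded {n : Type*} [Fintype n] [DecidableEq n] (M : Matrix n n ℝ) (b : n → ℕ)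
    (h1 : ∀ c, M c c = 1) (h2 : ∀ c d, M c d ≠ 0 → c = d ∨ b c < b d) : M.det = 1 := by
  have hb : M.BlockTriangular b := by
    intro c d h
    by_contra h0
    rcases h2 c d h0 with rfl | h'
    · exact lt_irrefl _ h
    · exact lt_asymm h h'
  rw [hb.det]
  refine prod_eq_one fun k _ => ?_
  have : M.toSquareBlock b k = 1 := by
    ext ⟨c, hc⟩ ⟨d, hd⟩
    rw [Matrix.toSquareBlock_def, Matrix.of_apply, Matrix.one_apply]
    by_cases hcd : c = d
    · subst hcd; simp [h1]
    · rw [if_neg (by simpa using hcd)]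
      by_contra h0
      rcases h2 c d h0 with h' | h'
      · exact hcd h'
      · omega
  rw [this, Matrix.det_one]

/-- A product of two indicators supported in `A` is constant on each `A`-cell. Summing over
`A`-cells diagonalizes the moment matrix by the unitriangular matrix `Z` of values of the
indicators. -/
lemma det_gram_cellsIn (w : (∀ γ, I γ) → ℝ) (A : Finset V) :
    ((gram i0 w).submatrix (Subtype.val : cellsIn i0 A → _) Subtype.val).det =
      cellProd i0 w A := by
  set Z : Matrix (cellsIn i0 A) (cellsIn i0 A) ℝ :=
    fun c d => ind (supp i0 c.1) c.1 d.1 with hZ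
  have hdet : Z.det = 1 := by
    refine det_eq_one_of_graded Z (fun c => (supp i0 c.1).card) (fun c => ind_self _ _) ?_
    intro c d h
    by_contra hn
    push Not at hn
    exact hn.1 (Subtype.ext (eq_of_ind_ne_zero i0 h hn.2))
  have hfac : (gram i0 w).submatrix (Subtype.val : cellsIn i0 A → _) Subtype.val =
      Z * Matrix.diagonal (fun c : cellsIn i0 A => ∑ i, w i * ind A c.1 i) * Z.transpose := by
    ext s t
    have hs := (mem_cellsIn i0).1 s.2
    have ht := (mem_cellsIn i0).1 t.2
    rw [Matrix.mul_apply]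
    simp_rw [Matrix.mul_diagonal, Matrix.transpose_apply]
    simp only [Matrix.submatrix_apply, gram, hZ]
    have h1 : ∀ i, ind (supp i0 s.1) s.1 i * ind (supp i0 t.1) t.1 i =
        ∑ d ∈ cellsIn i0 A, (ind (supp i0 s.1) s.1 d * ind (supp i0 t.1) t.1 d) * ind A d i := by
      intro i
      rw [sum_mul_ind]
      congr 1
      · exact ind_congr _ fun γ hγ => by rw [piecewise_eq_of_mem _ _ _ (hs hγ)]
      · exact ind_congr _ fun γ hγ => by rw [piecewise_eq_of_mem _ _ _ (ht hγ)]
    rw [sum_congr rfl fun i _ => by rw [h1 i, mul_sum], sum_comm, ← sum_coe_sort (cellsIn i0 A)]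
    refine sum_congr rfl fun d _ => ?_
    rw [mul_sum, sum_mul]
    exact sum_congr rfl fun i _ => by ring
  rw [hfac, Matrix.det_mul, Matrix.det_mul, Matrix.det_transpose, hdet, Matrix.det_diagonal,
    one_mul, mul_one, cellProd, ← prod_coe_sort (cellsIn i0 A)]

end Cells

/-! ### Schur complements without invertibility assumptions -/

section Blocks

variable {n : Type*} [DecidableEq n]

lemma det_fromBlocks_of_eq_mul {a b : Type*} [Fintype a] [Fintype b] [DecidableEq a]
    [DecidableEq b] (P : Matrix a a ℝ) (X : Matrix a b ℝ) (R : Matrix b a ℝ) (D : Matrix b b ℝ) :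
    (Matrix.fromBlocks P (P * X) R D).det = P.det * (D - R * X).det := by
  have : Matrix.fromBlocks P (P * X) R D =
      Matrix.fromBlocks P 0 R (D - R * X) * Matrix.fromBlocks 1 X 0 1 := by
    rw [Matrix.fromBlocks_multiply]
    simp
  rw [this, Matrix.det_mul, Matrix.det_fromBlocks_zero₁₂, Matrix.det_fromBlocks_zero₂₁]
  simp

lemma det_submatrix_union (M : Matrix n n ℝ) (X : n → n → ℝ) {S J K : Finset n} (hSJ : S ⊆ J)
    (hJK : Disjoint J K) (hX : ∀ s ∈ J, ∀ t ∈ K, M s t = ∑ u ∈ S, M s u * X u t) :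
    (M.submatrix (Subtype.val : ↥(J ∪ K) → n) Subtype.val).det =
      (M.submatrix (Subtype.val : J → n) Subtype.val).det *
        (Matrix.of fun s t : K => M s t - ∑ u ∈ S, M s u * X u t).det := by
  -- The coefficients are extended by zero from `S` to all of `J`.
  have hsum : ∀ s t, ∑ u : J, M s u.1 * (if u.1 ∈ S then X u.1 t else 0) =
      ∑ u ∈ S, M s u * X u t := by
    intro s t
    rw [sum_coe_sort J (fun u => M s u * (if u ∈ S then X u t else 0))]
    simp_rw [mul_ite, mul_zero]
    rw [← sum_filter, filter_mem_eq_inter, inter_eq_right.2 hSJ]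
  rw [← Matrix.det_submatrix_equiv_self (Equiv.Finset.union J K hJK)]
  have := det_fromBlocks_of_eq_mul (M.submatrix (Subtype.val : J → n) (Subtype.val : J → n))
    (Matrix.of fun (u : J) (t : K) => if u.1 ∈ S then X u.1 t.1 else 0)
    (M.submatrix (Subtype.val : K → n) (Subtype.val : J → n))
    (M.submatrix (Subtype.val : K → n) (Subtype.val : K → n))
  convert this using 2
  · ext (s | s) (t | t)
    · rfl
    · simp only [Matrix.submatrix_apply, Matrix.fromBlocks_apply₁₂, Matrix.mul_apply,
        Matrix.of_apply]
      rw [hsum]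
      exact hX s.1 s.2 t.1 t.2
    · rfl
    · rfl
  · congr 1
    ext s t
    simp only [Matrix.sub_apply, Matrix.submatrix_apply, Matrix.mul_apply, Matrix.of_apply]
    rw [hsum]

/-- The Schur complement involves only `S` and `K`, so it is the same factor whether `K` is adjoined
to `J` or to `S`. -/
lemma det_union_mul_det (M : Matrix n n ℝ) (X : n → n → ℝ) {S J K : Finset n} (hSJ : S ⊆ J)
    (hJK : Disjoint J K) (hX : ∀ s ∈ J, ∀ t ∈ K, M s t = ∑ u ∈ S, M s u * X u t) :
    (M.submatrix (Subtype.val : ↥(J ∪ K) → n) Subtype.val).det *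
        (M.submatrix (Subtype.val : S → n) Subtype.val).det =
      (M.submatrix (Subtype.val : J → n) Subtype.val).det *
        (M.submatrix (Subtype.val : ↥(S ∪ K) → n) Subtype.val).det := by
  rw [det_submatrix_union M X hSJ hJK hX,
    det_submatrix_union M X subset_rfl (disjoint_of_subset_left hSJ hJK)
      fun s hs t ht => hX s (hSJ hs) t ht]
  ring

end Blocks

/-! ### Conditional means and the product formula along a running intersection sequence -/

section Factorization

variable {V : Type*} [Fintype V] [DecidableEq V]
variable {I : V → Type*} [∀ γ, DecidableEq (I γ)] [∀ γ, Fintype (I γ)]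

/-- Exchanging the coordinates outside `H` between `i` and `j` is an involution of the pairs, under
which the summand becomes a function of one component. -/
lemma sum_sum_piecewise (H : Finset V) (f : (∀ γ, I γ) → ℝ) :
    ∑ i, ∑ j, f (H.piecewise i j) = Fintype.card (∀ γ, I γ) * ∑ i, f i := by
  have hinv : Function.Involutive fun x : (∀ γ, I γ) × (∀ γ, I γ) =>
      (H.piecewise x.1 x.2, H.piecewise x.2 x.1) := by
    rintro ⟨i, j⟩
    refine Prod.ext ?_ ?_ <;>
    · funext γ
      by_cases h : γ ∈ H <;> simp [h]
  have h1 := Equiv.sum_comp hinv.toPerm fun x : (∀ γ, I γ) × (∀ γ, I γ) => f x.1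
  simp only [Function.Involutive.coe_toPerm, Fintype.sum_prod_type] at h1
  rw [h1, mul_sum]
  simp

/-- The average of `h` over the coordinates outside `H`. -/
noncomputable def condMean (H : Finset V) (h : (∀ γ, I γ) → ℝ) (i : ∀ γ, I γ) : ℝ :=
  (Fintype.card (∀ γ, I γ) : ℝ)⁻¹ * ∑ j, h (H.piecewise i j)

/-- The defining property of a conditional expectation given `i_H`, for the counting measure. -/
lemma sum_mul_condMean [Nonempty (∀ γ, I γ)] {H : Finset V} {F : (∀ γ, I γ) → ℝ}
    (hF : DependsOn F (H : Set V)) (h : (∀ γ, I γ) → ℝ) :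
    ∑ i, F i * condMean H h i = ∑ i, F i * h i := by
  have h0 : (Fintype.card (∀ γ, I γ) : ℝ) ≠ 0 :=
    Nat.cast_ne_zero.2 Fintype.card_ne_zero
  have h1 := sum_sum_piecewise H fun i => F i * h i
  have h2 : ∑ i, F i * condMean H h i = (Fintype.card (∀ γ, I γ) : ℝ)⁻¹ *
      ∑ i, ∑ j, F (H.piecewise i j) * h (H.piecewise i j) := by
    rw [mul_sum]
    refine sum_congr rfl fun i _ => ?_
    rw [condMean, mul_left_comm, mul_sum]
    congr 1
    refine sum_congr rfl fun j _ => ?_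
    congr 1
    exact hF fun γ hγ => (piecewise_eq_of_mem _ _ _ hγ).symm
  rw [h2, h1, inv_mul_cancel_left₀ h0]

lemma dependsOn_condMean {H A : Finset V} {h : (∀ γ, I γ) → ℝ} (hh : DependsOn h (A : Set V)) :
    DependsOn (condMean H h) ((A ∩ H : Finset V) : Set V) := by
  intro i i' hi
  unfold condMean
  congr 1
  refine sum_congr rfl fun j _ => hh fun γ hγ => ?_
  by_cases hH : γ ∈ H
  · simp [hH, hi γ (mem_coe.2 (mem_inter.2 ⟨hγ, hH⟩))]
  · simp [hH]

lemma condMean_pos [Nonempty (∀ γ, I γ)] (H : Finset V) {h : (∀ γ, I γ) → ℝ}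
    (hh : ∀ i, 0 < h i) (i : ∀ γ, I γ) : 0 < condMean H h i := by
  unfold condMean
  have : 0 < ∑ j, h (H.piecewise i j) := sum_pos (fun j _ => hh _) univ_nonempty
  have h0 : (0 : ℝ) < Fintype.card (∀ γ, I γ) := by exact_mod_cast Fintype.card_pos
  positivity

lemma dependsOn_ind (A : Finset V) (c : ∀ γ, I γ) : DependsOn (ind A c) (A : Set V) :=
  fun _ _ h => ind_congr c h

lemma _root_.DependsOn.mul_real {s : Set V} {f g : (∀ γ, I γ) → ℝ} (hf : DependsOn f s)
    (hg : DependsOn g s) : DependsOn (fun i => f i * g i) s :=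
  fun i j h => by simp only [hf h, hg h]

variable (i0 : ∀ γ, I γ)

/-- The principal minor of `gram` with index set `J`. -/
def gramDet (w : (∀ γ, I γ) → ℝ) (J : Finset (∀ γ, I γ)) : ℝ :=
  ((gram i0 w).submatrix (Subtype.val : J → _) Subtype.val).det

lemma gramDet_cellsIn (w : (∀ γ, I γ) → ℝ) (A : Finset V) :
    gramDet i0 w (cellsIn i0 A) = cellProd i0 w A := det_gram_cellsIn i0 w A

/-- The cells whose support is contained in one of the first `n` sets of a sequence. -/
def cellsUpTo (C : ℕ → Finset V) (n : ℕ) : Finset (∀ γ, I γ) :=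
  univ.filter fun c => ∃ j < n, supp i0 c ⊆ C j

/-- The intersection of the `n`-th set of a sequence with the union of the earlier ones. -/
def sep (C : ℕ → Finset V) (n : ℕ) : Finset V := C n ∩ (range n).biUnion C

@[simp] lemma mem_cellsUpTo {C : ℕ → Finset V} {n : ℕ} {c : ∀ γ, I γ} :
    c ∈ cellsUpTo i0 C n ↔ ∃ j < n, supp i0 c ⊆ C j := by simp [cellsUpTo]

/-- Minors over cells supported in `H` see only the `H`-marginal of the density; this allows
densities to be exchanged in the induction below. -/
lemma gramDet_congr {w w' : (∀ γ, I γ) → ℝ} {H : Finset V}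
    (hw : ∀ F : (∀ γ, I γ) → ℝ, DependsOn F (H : Set V) → ∑ i, w i * F i = ∑ i, w' i * F i)
    {J : Finset (∀ γ, I γ)} (hJ : ∀ c ∈ J, supp i0 c ⊆ H) : gramDet i0 w J = gramDet i0 w' J := by
  unfold gramDet
  congr 1
  ext s t
  exact hw _ (((dependsOn_ind _ _).mono (coe_subset.2 (hJ s.1 s.2))).mul_real
    ((dependsOn_ind _ _).mono (coe_subset.2 (hJ t.1 t.2))))

lemma cellProd_congr {w w' : (∀ γ, I γ) → ℝ} {H : Finset V}
    (hw : ∀ F : (∀ γ, I γ) → ℝ, DependsOn F (H : Set V) → ∑ i, w i * F i = ∑ i, w' i * F i)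
    {A : Finset V} (hA : A ⊆ H) : cellProd i0 w A = cellProd i0 w' A :=
  prod_congr rfl fun c _ => hw _ ((dependsOn_ind A c).mono (coe_subset.2 hA))

/-- If `f` depends only on `i_H`, `ψ` only on `i_A`, then under the density `f ψ` the cells of
`A` and of `H` are conditionally independent given `A ∩ H`, and the principal minors of the
moment matrix satisfy the corresponding product formula. -/
lemma gramDet_mul_gramDet {H A : Finset V} {f ψ : (∀ γ, I γ) → ℝ} (hf : DependsOn f (H : Set V))
    (hψ : DependsOn ψ (A : Set V)) (hpos : ∀ i, 0 < ψ i) {J : Finset (∀ γ, I γ)}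
    (hJ : ∀ c ∈ J, supp i0 c ⊆ H) (hSJ : cellsIn i0 (A ∩ H) ⊆ J) :
    gramDet i0 (fun i => f i * ψ i) (J ∪ cellsIn i0 A) *
        cellProd i0 (fun i => f i * ψ i) (A ∩ H) =
      gramDet i0 (fun i => f i * ψ i) J * cellProd i0 (fun i => f i * ψ i) A := by
  have : Nonempty (∀ γ, I γ) := ⟨i0⟩
  -- The quotient is the conditional mean of the indicator of `t` given `i_H` under `f ψ`, since `f`
  -- cancels. It depends only on `i_{A ∩ H}`, so it is a combination of separator indicators, whose
  -- coefficients express the columns of `A` through those of the separator.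
  have hr : ∀ t : ∀ γ, I γ, ∃ u : (∀ γ, I γ) → ℝ, t ∈ cellsIn i0 A →
      ∀ i, condMean H (fun i => ψ i * ind (supp i0 t) t i) i / condMean H ψ i =
        ∑ d ∈ cellsIn i0 (A ∩ H), u d * ind (supp i0 d) d i := by
    intro t
    by_cases ht : t ∈ cellsIn i0 A
    · have h1 := dependsOn_condMean (H := H)
        (hψ.mul_real ((dependsOn_ind (supp i0 t) t).mono (coe_subset.2 ((mem_cellsIn i0).1 ht))))
      have h2 := dependsOn_condMean (H := H) hψ
      obtain ⟨u, hu⟩ := exists_eq_sum_of_dependsOn i0 (A ∩ H)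
        (fun i => condMean H (fun i => ψ i * ind (supp i0 t) t i) i / condMean H ψ i)
        (fun i j h => by simp only [h1 h, h2 h])
      exact ⟨u, fun _ => hu⟩
    · exact ⟨0, fun h => absurd h ht⟩
  choose u hu using hr
  have hdis : Disjoint J (cellsIn i0 A \ cellsIn i0 (A ∩ H)) := by
    rw [disjoint_left]
    intro c hc hc'
    simp only [mem_sdiff, mem_cellsIn] at hc'
    exact hc'.2 (subset_inter hc'.1 (hJ c hc))
  have key := det_union_mul_det (gram i0 fun i => f i * ψ i) (fun d t => u t d) hSJ hdis
    (by
      intro s hs t ht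
      have ht' := (mem_sdiff.1 ht).1
      have hfs : DependsOn (fun i => f i * ind (supp i0 s) s i) (H : Set V) :=
        hf.mul_real ((dependsOn_ind _ _).mono (coe_subset.2 (hJ s hs)))
      have hS : ∀ d ∈ cellsIn i0 (A ∩ H), supp i0 d ⊆ H := fun d hd =>
        ((mem_cellsIn i0).1 hd).trans inter_subset_right
      have hrH : DependsOn (fun i => ∑ d ∈ cellsIn i0 (A ∩ H), u t d * ind (supp i0 d) d i)
          (H : Set V) := fun i j h => sum_congr rfl fun d hd => by
        rw [(dependsOn_ind (supp i0 d) d).mono (coe_subset.2 (hS d hd)) h]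
      calc gram i0 (fun i => f i * ψ i) s t
          = ∑ i, (f i * ind (supp i0 s) s i) * (ψ i * ind (supp i0 t) t i) :=
            sum_congr rfl fun i _ => by ring
        _ = ∑ i, (f i * ind (supp i0 s) s i) *
              condMean H (fun i => ψ i * ind (supp i0 t) t i) i :=
            (sum_mul_condMean hfs _).symm
        _ = ∑ i, ((f i * ind (supp i0 s) s i) *
              ∑ d ∈ cellsIn i0 (A ∩ H), u t d * ind (supp i0 d) d i) * condMean H ψ i := by
            refine sum_congr rfl fun i _ => ?_
            rw [← hu t ht' i]
            have := (condMean_pos H hpos i).ne'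
            field_simp
        _ = ∑ i, ((f i * ind (supp i0 s) s i) *
              ∑ d ∈ cellsIn i0 (A ∩ H), u t d * ind (supp i0 d) d i) * ψ i :=
            sum_mul_condMean (hfs.mul_real hrH) _
        _ = ∑ d ∈ cellsIn i0 (A ∩ H), gram i0 (fun i => f i * ψ i) s d * u t d := by
            simp only [gram, sum_mul, mul_sum]
            rw [sum_comm]
            exact sum_congr rfl fun d _ => sum_congr rfl fun i _ => by ring)
  have hU1 : J ∪ (cellsIn i0 A \ cellsIn i0 (A ∩ H)) = J ∪ cellsIn i0 A := by
    ext c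
    simp only [mem_union, mem_sdiff]
    constructor
    · tauto
    · rintro (h | h)
      · exact Or.inl h
      · by_cases h' : c ∈ cellsIn i0 (A ∩ H)
        · exact Or.inl (hSJ h')
        · exact Or.inr ⟨h, h'⟩
  have hU2 : cellsIn i0 (A ∩ H) ∪ (cellsIn i0 A \ cellsIn i0 (A ∩ H)) = cellsIn i0 A :=
    union_sdiff_of_subset fun c hc => by
      rw [mem_cellsIn] at hc ⊢
      exact hc.trans inter_subset_left
  change gramDet i0 _ (J ∪ (cellsIn i0 A \ cellsIn i0 (A ∩ H))) *
    gramDet i0 _ (cellsIn i0 (A ∩ H)) = gramDet i0 _ J *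
    gramDet i0 _ (cellsIn i0 (A ∩ H) ∪ (cellsIn i0 A \ cellsIn i0 (A ∩ H))) at key
  rwa [hU1, hU2, gramDet_cellsIn, gramDet_cellsIn] at key

/-- For a density that factorizes over a sequence of sets with the running intersection property,
the principal minor of the moment matrix is the ratio of the products over the sets and over the
separators. -/
theorem gramDet_cellsUpTo (C : ℕ → Finset V) (n : ℕ)
    (hC : ∀ l < n, ∃ j ≤ l, sep C (l + 1) ⊆ C j) (ψ : ℕ → (∀ γ, I γ) → ℝ)
    (hpos : ∀ j i, 0 < ψ j i) (hdep : ∀ j, DependsOn (ψ j) (C j : Set V)) :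
    gramDet i0 (fun i => ∏ j ∈ range (n + 1), ψ j i) (cellsUpTo i0 C (n + 1)) *
        ∏ l ∈ range n, cellProd i0 (fun i => ∏ j ∈ range (n + 1), ψ j i) (sep C (l + 1)) =
      ∏ l ∈ range (n + 1), cellProd i0 (fun i => ∏ j ∈ range (n + 1), ψ j i) (C l) := by
  have : Nonempty (∀ γ, I γ) := ⟨i0⟩
  induction n generalizing ψ with
  | zero =>
    have : cellsUpTo i0 C (0 + 1) = cellsIn i0 (C 0) := by ext; simp
    simp [this, gramDet_cellsIn]
  | succ n ih =>
    set H := (range (n + 1)).biUnion C with hH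
    have hCH : ∀ j < n + 1, C j ⊆ H := fun j hj =>
      subset_biUnion_of_mem C (mem_range.2 hj)
    obtain ⟨j₀, hj₀, hS⟩ := hC n (Nat.lt_succ_self n)
    have hj₀' : j₀ < n + 1 := Nat.lt_succ_of_le hj₀
    have hg := dependsOn_condMean (H := H) (hdep (n + 1))
    -- Averaging the last factor over the coordinates outside `H` leaves a function of the
    -- separator. As the separator lies in `C j₀`, that function is absorbed into the factor with
    -- index `j₀`, and the induction hypothesis applies to the resulting density.
    have hih := ih (fun l hl => hC l (hl.trans (Nat.lt_succ_self n)))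
      (fun j i => ψ j i * if j = j₀ then condMean H (ψ (n + 1)) i else 1)
      (fun j i => by
        split_ifs
        · exact mul_pos (hpos j i) (condMean_pos H (hpos _) i)
        · simpa using hpos j i)
      (fun j => by
        by_cases h : j = j₀
        · subst h
          simp only [if_true]
          exact (hdep j).mul_real (hg.mono (coe_subset.2 hS))
        · simpa [h] using hdep j)
    simp only [prod_mul_distrib, prod_ite_eq', mem_range, hj₀', if_true] at hih
    have hf : DependsOn (fun i => ∏ j ∈ range (n + 1), ψ j i) (H : Set V) := fun i i' h =>
      prod_congr rfl fun j hj => (hdep j).mono (coe_subset.2 (hCH j (mem_range.1 hj))) h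
    -- The shortened density has the same `H`-marginal as the full one, so every term of the
    -- induction hypothesis may be computed with the full density.
    have hw : ∀ F : (∀ γ, I γ) → ℝ, DependsOn F (H : Set V) →
        ∑ i, ((∏ j ∈ range (n + 1), ψ j i) * condMean H (ψ (n + 1)) i) * F i =
          ∑ i, ((∏ j ∈ range (n + 1), ψ j i) * ψ (n + 1) i) * F i := by
      intro F hF
      have := sum_mul_condMean (hf.mul_real hF) (ψ (n + 1))
      simpa only [mul_right_comm] using this
    have hJ : ∀ c ∈ cellsUpTo i0 C (n + 1), supp i0 c ⊆ H := fun c hc => by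
      obtain ⟨j, hj, h⟩ := (mem_cellsUpTo i0).1 hc
      exact h.trans (hCH j hj)
    have hstep := gramDet_mul_gramDet i0 hf (hdep (n + 1)) (hpos (n + 1)) hJ
      (fun c hc => (mem_cellsUpTo i0).2 ⟨j₀, hj₀', ((mem_cellsIn i0).1 hc).trans hS⟩)
    rw [gramDet_congr i0 hw hJ] at hih
    rw [prod_congr rfl fun l hl => cellProd_congr i0 hw (A := sep C (l + 1))
      (inter_subset_left.trans (hCH (l + 1) (by simpa using hl))),
      prod_congr rfl fun l hl => cellProd_congr i0 hw (hCH l (mem_range.1 hl))] at hih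
    have hU : cellsUpTo i0 C (n + 1 + 1) = cellsUpTo i0 C (n + 1) ∪ cellsIn i0 (C (n + 1)) := by
      ext c
      simp only [mem_union, mem_cellsUpTo, mem_cellsIn, Nat.lt_succ_iff_lt_or_eq (n := n + 1)]
      constructor
      · rintro ⟨j, hj | rfl, h⟩
        · exact Or.inl ⟨j, hj, h⟩
        · exact Or.inr h
      · rintro (⟨j, hj, h⟩ | h)
        · exact ⟨j, Or.inl hj, h⟩
        · exact ⟨n + 1, Or.inr rfl, h⟩
    have hsep : C (n + 1) ∩ H = sep C (n + 1) := rfl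
    simp only [prod_range_succ _ (n + 1)]
    rw [prod_range_succ _ n, hU, ← hih]
    rw [hsep] at hstep
    linear_combination (∏ l ∈ range n, cellProd i0
      (fun i => (∏ j ∈ range (n + 1), ψ j i) * ψ (n + 1) i) (sep C (l + 1))) * hstep

end Factorization

/-! ### Möbius inversion on the subsets of a finite set -/

section Mobius

variable {V : Type*} [DecidableEq V]

lemma sum_neg_one_pow_card_powerset {R : Type*} [CommRing R] (X : Finset V) :
    ∑ F ∈ X.powerset, (-1 : R) ^ F.card = if X = ∅ then 1 else 0 := by
  have h := congrArg (Int.cast : ℤ → R) (sum_powerset_neg_one_pow_card (x := X))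
  push_cast at h
  exact h

/-- After exchanging the sums, `g D` is multiplied by the alternating sum over the interval between
`D` and `E`, which vanishes unless `D = E`. The inversion in the other order rests on the same
cancellation. -/
lemma mobius_sum_powerset (g : Finset V → ℝ) (E : Finset V) :
    ∑ F ∈ E.powerset, (-1 : ℝ) ^ (E \ F).card * ∑ D ∈ F.powerset, g D = g E := by
  simp_rw [mul_sum]
  rw [sum_comm' (t' := E.powerset) (s' := fun D => E.powerset.filter (D ⊆ ·))
    (by
      intro F D
      simp only [mem_powerset, mem_filter]
      exact ⟨fun h => ⟨h, h.2.trans h.1⟩, fun h => h.1⟩)]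
  have key : ∀ D ∈ E.powerset, ∑ F ∈ E.powerset.filter (D ⊆ ·), (-1 : ℝ) ^ (E \ F).card * g D =
      if D = E then g D else 0 := by
    intro D hD
    rw [mem_powerset] at hD
    rw [← sum_mul]
    have : ∑ F ∈ E.powerset.filter (D ⊆ ·), (-1 : ℝ) ^ (E \ F).card =
        ∑ F ∈ (E \ D).powerset, (-1 : ℝ) ^ F.card := by
      refine sum_nbij' (fun F => E \ F) (fun F => E \ F) ?_ ?_ ?_ ?_ ?_
      · intro F hF
        simp only [mem_filter, mem_powerset] at hF ⊢
        exact sdiff_subset_sdiff subset_rfl hF.2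
      · intro F hF
        simp only [mem_filter, mem_powerset] at hF ⊢
        refine ⟨sdiff_subset, fun γ hγ => mem_sdiff.2 ⟨hD hγ, fun h => ?_⟩⟩
        exact (mem_sdiff.1 (hF h)).2 hγ
      · intro F hF
        simp only [mem_filter, mem_powerset] at hF
        exact Finset.sdiff_sdiff_eq_self hF.1
      · intro F hF
        simp only [mem_powerset] at hF
        exact Finset.sdiff_sdiff_eq_self (hF.trans sdiff_subset)
      · intro F _
        rfl
    rw [this, sum_neg_one_pow_card_powerset]
    by_cases h : D = E
    · subst h; simp
    · have : E \ D ≠ ∅ := fun h' => h (hD.antisymm (sdiff_eq_empty_iff_subset.1 h'))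
      simp [h, this]
  rw [sum_congr rfl key]
  simp

lemma sum_powerset_mobius (g : Finset V → ℝ) (E : Finset V) :
    ∑ F ∈ E.powerset, ∑ D ∈ F.powerset, (-1 : ℝ) ^ (F \ D).card * g D = g E := by
  rw [sum_comm' (t' := E.powerset) (s' := fun D => E.powerset.filter (D ⊆ ·))
    (by
      intro F D
      simp only [mem_powerset, mem_filter]
      exact ⟨fun h => ⟨h, h.2.trans h.1⟩, fun h => h.1⟩)]
  have key : ∀ D ∈ E.powerset, ∑ F ∈ E.powerset.filter (D ⊆ ·), (-1 : ℝ) ^ (F \ D).card * g D =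
      if D = E then g D else 0 := by
    intro D hD
    rw [mem_powerset] at hD
    rw [← sum_mul]
    have : ∑ F ∈ E.powerset.filter (D ⊆ ·), (-1 : ℝ) ^ (F \ D).card =
        ∑ F ∈ (E \ D).powerset, (-1 : ℝ) ^ F.card := by
      refine sum_nbij' (fun F => F \ D) (fun F => F ∪ D) ?_ ?_ ?_ ?_ ?_
      · intro F hF
        simp only [mem_filter, mem_powerset] at hF ⊢
        exact sdiff_subset_sdiff hF.1 subset_rfl
      · intro F hF
        simp only [mem_filter, mem_powerset] at hF ⊢
        exact ⟨union_subset (hF.trans sdiff_subset) hD, subset_union_right⟩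
      · intro F hF
        simp only [mem_filter, mem_powerset] at hF
        exact sdiff_union_of_subset hF.2
      · intro F hF
        simp only [mem_powerset] at hF
        exact union_sdiff_cancel_right (disjoint_sdiff_self_left.mono_left hF)
      · intro F _
        rfl
    rw [this, sum_neg_one_pow_card_powerset]
    by_cases h : D = E
    · subst h; simp
    · have : E \ D ≠ ∅ := fun h' => h (hD.antisymm (sdiff_eq_empty_iff_subset.1 h'))
      simp [h, this]
  rw [sum_congr rfl key]
  simp

end Mobius

/-! ### The log-linear parametrization of the model -/

section Model

variable {V : Type*} [Fintype V] [DecidableEq V]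
variable {I : V → Type*} [∀ γ, DecidableEq (I γ)] [∀ γ, Fintype (I γ)] (i0 : ∀ γ, I γ)

/-- The Möbius transform of a function of the cells. -/
def mob (L : (∀ γ, I γ) → ℝ) (c : ∀ γ, I γ) : ℝ :=
  ∑ F ∈ (supp i0 c).powerset, (-1 : ℝ) ^ (supp i0 c \ F).card * L (F.piecewise c i0)

/-- The cells whose indicator is nonzero at `i` are the truncations of `i`, one for each subset of
its support. -/
lemma sum_mul_ind_supp (η : (∀ γ, I γ) → ℝ) (i : ∀ γ, I γ) :
    ∑ c, η c * ind (supp i0 c) c i = ∑ F ∈ (supp i0 i).powerset, η (F.piecewise i i0) := by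
  simp only [ind, mul_ite, mul_one, mul_zero]
  rw [← sum_filter]
  refine sum_nbij' (fun c => supp i0 c) (fun F => F.piecewise i i0) ?_ ?_ ?_ ?_ ?_
  · intro c hc
    simp only [mem_filter, mem_univ, true_and, mem_powerset] at hc ⊢
    intro γ hγ
    have := hc γ hγ
    rw [mem_supp] at hγ ⊢
    rwa [this]
  · intro F hF
    simp only [mem_filter, mem_univ, true_and]
    intro γ hγ
    rw [supp_piecewise] at hγ
    simp [(mem_inter.1 hγ).1]
  · intro c hc
    simp only [mem_filter, mem_univ, true_and] at hc
    funext γ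
    by_cases hγ : γ ∈ supp i0 c
    · simpa [hγ] using hc γ hγ
    · rw [piecewise_eq_of_notMem _ _ _ hγ, eq_of_notMem_supp i0 hγ]
  · intro F hF
    rw [supp_piecewise]
    exact inter_eq_left.2 (mem_powerset.1 hF)
  · intro c hc
    simp only [mem_filter, mem_univ, true_and] at hc
    congr 1
    funext γ
    by_cases hγ : γ ∈ supp i0 c
    · simpa [hγ] using (hc γ hγ).symm
    · rw [piecewise_eq_of_notMem _ _ _ hγ, eq_of_notMem_supp i0 hγ]

lemma piecewise_piecewise_of_subset {D F : Finset V} (h : D ⊆ F) (c : ∀ γ, I γ) :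
    D.piecewise (F.piecewise c i0) i0 = D.piecewise c i0 := by
  funext γ
  by_cases hγ : γ ∈ D
  · simp [hγ, h hγ]
  · simp [hγ]

lemma mob_sum_mul_ind (η : (∀ γ, I γ) → ℝ) (c : ∀ γ, I γ) :
    mob i0 (fun i => ∑ d, η d * ind (supp i0 d) d i) c = η c := by
  unfold mob
  simp only [sum_mul_ind_supp]
  have h : ∀ F ∈ (supp i0 c).powerset,
      (-1 : ℝ) ^ (supp i0 c \ F).card *
        ∑ D ∈ (supp i0 (F.piecewise c i0)).powerset, η (D.piecewise (F.piecewise c i0) i0) =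
      (-1 : ℝ) ^ (supp i0 c \ F).card * ∑ D ∈ F.powerset, η (D.piecewise c i0) := by
    intro F hF
    rw [supp_piecewise, inter_eq_left.2 (mem_powerset.1 hF)]
    congr 1
    exact sum_congr rfl fun D hD => by rw [piecewise_piecewise_of_subset i0 (mem_powerset.1 hD)]
  rw [sum_congr rfl h, mobius_sum_powerset (fun D => η (D.piecewise c i0)),
    piecewise_eq_self i0 subset_rfl]

lemma sum_mob_mul_ind (L : (∀ γ, I γ) → ℝ) (i : ∀ γ, I γ) :
    ∑ c, mob i0 L c * ind (supp i0 c) c i = L i := by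
  rw [sum_mul_ind_supp]
  have h : ∀ F ∈ (supp i0 i).powerset, mob i0 L (F.piecewise i i0) =
      ∑ D ∈ F.powerset, (-1 : ℝ) ^ (F \ D).card * L (D.piecewise i i0) := by
    intro F hF
    rw [mob, supp_piecewise, inter_eq_left.2 (mem_powerset.1 hF)]
    exact sum_congr rfl fun D hD => by rw [piecewise_piecewise_of_subset i0 (mem_powerset.1 hD)]
  rw [sum_congr rfl h, sum_powerset_mobius (fun D => L (D.piecewise i i0)),
    piecewise_eq_self i0 subset_rfl]

lemma supp_extend {E : Finset V} (x : StarCell i0 E) : supp i0 (extend i0 x.1) = E := by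
  ext γ
  rw [mem_supp]
  by_cases h : γ ∈ E
  · simpa [extend, h] using x.2 ⟨γ, h⟩
  · simp [extend, h]

lemma logLinear_eq_mob (p : (∀ γ, I γ) → ℝ) {E : Finset V} (x : StarCell i0 E) :
    logLinear i0 p E x.1 = mob i0 (fun i => Real.log (p i)) (extend i0 x.1) := by
  rw [mob, supp_extend, logLinear]

variable {i0} {G : SimpleGraph V}

/-- The full cell `(i_D, i_{D^c}^*)` of an index `(D, i_D)`. -/
def ParamIndex.toCell (t : ParamIndex G i0) : ∀ γ, I γ := extend i0 t.cell

lemma ParamIndex.supp_toCell (t : ParamIndex G i0) : supp i0 t.toCell = t.set :=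
  supp_extend i0 t.2

lemma ParamIndex.toCell_apply (t : ParamIndex G i0) {γ : V} (h : γ ∈ t.set) :
    t.toCell γ = t.cell ⟨γ, h⟩ := by
  simp [ParamIndex.toCell, extend, h]

lemma ParamIndex.toCell_injective :
    Function.Injective (ParamIndex.toCell : ParamIndex G i0 → ∀ γ, I γ) := by
  rintro ⟨⟨D, hD⟩, x⟩ ⟨⟨D', hD'⟩, x'⟩ h
  have h1 : D = D' := by
    have e1 := ParamIndex.supp_toCell (⟨⟨D, hD⟩, x⟩ : ParamIndex G i0)
    have e2 := ParamIndex.supp_toCell (⟨⟨D', hD'⟩, x'⟩ : ParamIndex G i0)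
    rw [h] at e1
    exact e1.symm.trans e2
  subst h1
  have h2 : x = x' := by
    refine Subtype.ext (funext fun γ => ?_)
    have := congrFun h γ.1
    exact (ParamIndex.toCell_apply (⟨⟨D, hD⟩, x⟩ : ParamIndex G i0) γ.2).symm.trans
      (this.trans (ParamIndex.toCell_apply (⟨⟨D, hD'⟩, x'⟩ : ParamIndex G i0) γ.2))
  rw [h2]

lemma ParamIndex.exists_toCell_eq {c : ∀ γ, I γ} (h1 : (supp i0 c).Nonempty)
    (h2 : G.IsClique (supp i0 c : Set V)) : ∃ t : ParamIndex G i0, t.toCell = c := by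
  refine ⟨⟨⟨supp i0 c, h1, h2⟩, ⟨fun γ => c γ, fun γ => (mem_supp i0).1 γ.2⟩⟩, ?_⟩
  funext γ
  by_cases h : γ ∈ supp i0 c
  · exact ParamIndex.toCell_apply _ h
  · rw [eq_of_notMem_supp i0 h]
    exact dif_neg h

lemma ParamIndex.set_nonempty (t : ParamIndex G i0) : t.set.Nonempty := t.1.2.1

lemma ParamIndex.isClique_set (t : ParamIndex G i0) : G.IsClique (t.set : Set V) := t.1.2.2

lemma ParamIndex.toCell_ne (t : ParamIndex G i0) : t.toCell ≠ i0 := fun h =>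
  t.set_nonempty.ne_empty (by rw [← t.supp_toCell, h, supp_self])

/-- The indicator function of the event `i_D = t.cell`. -/
def stat (t : ParamIndex G i0) (i : ∀ γ, I γ) : ℝ := ind (supp i0 t.toCell) t.toCell i

lemma stat_eq_ite (t : ParamIndex G i0) (i : ∀ γ, I γ) :
    stat t i = if t.set.restrict i = t.cell then 1 else 0 := by
  rw [stat, ind, t.supp_toCell]
  congr 1
  refine propext ⟨fun h => ?_, fun h γ hγ => ?_⟩
  · funext γ
    exact (h γ.1 γ.2).trans (t.toCell_apply γ.2)
  · rw [t.toCell_apply hγ, ← h]; rfl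

lemma weight_eq (θ : ParamIndex G i0 → ℝ) (i : ∀ γ, I γ) :
    weight G i0 θ i = Real.exp (∑ t, θ t * stat t i) := by
  simp only [weight, stat_eq_ite, mul_ite, mul_one, mul_zero, sum_filter]

/-- The empty support supplies the constant term, and the nonempty complete supports are exactly
those of the parameter indices. -/
lemma sum_eq_add_sum_toCell {g : (∀ γ, I γ) → ℝ}
    (hg : ∀ c, (supp i0 c).Nonempty → ¬ G.IsClique (supp i0 c : Set V) → g c = 0) :
    ∑ c, g c = g i0 + ∑ t : ParamIndex G i0, g t.toCell := by
  classical
  rw [← sum_image (s := univ) (g := ParamIndex.toCell) (f := g)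
    ParamIndex.toCell_injective.injOn, ← sum_insert]
  · symm
    refine sum_subset (subset_univ _) fun c _ hc => ?_
    rw [mem_insert, not_or] at hc
    have h1 : (supp i0 c).Nonempty := by
      rw [nonempty_iff_ne_empty, Ne, supp_eq_empty]
      exact hc.1
    refine hg c h1 fun h2 => hc.2 ?_
    obtain ⟨t, ht⟩ := ParamIndex.exists_toCell_eq h1 h2
    exact mem_image.2 ⟨t, mem_univ _, ht⟩
  · intro h
    obtain ⟨t, -, ht⟩ := mem_image.1 h
    exact t.toCell_ne ht

lemma weight_pos (θ : ParamIndex G i0 → ℝ) (i : ∀ γ, I γ) : 0 < weight G i0 θ i :=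
  Real.exp_pos _

lemma sum_weight_pos (θ : ParamIndex G i0 → ℝ) : 0 < ∑ i, weight G i0 θ i :=
  sum_pos (fun i _ => weight_pos θ i) ⟨i0, mem_univ _⟩

lemma cellProb_pos (θ : ParamIndex G i0 → ℝ) (i : ∀ γ, I γ) : 0 < cellProb G i0 θ i :=
  div_pos (weight_pos θ i) (sum_weight_pos θ)

lemma sum_cellProb (θ : ParamIndex G i0 → ℝ) : ∑ i, cellProb G i0 θ i = 1 := by
  simp only [cellProb]
  rw [← sum_div, div_self (sum_weight_pos θ).ne']

lemma log_cellProb (θ : ParamIndex G i0 → ℝ) (i : ∀ γ, I γ) :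
    Real.log (cellProb G i0 θ i) =
      ∑ t, θ t * stat t i - Real.log (∑ j, weight G i0 θ j) := by
  rw [cellProb, Real.log_div (weight_pos θ i).ne' (sum_weight_pos θ).ne', weight_eq, Real.log_exp]

lemma exists_log_cellProb_eq (θ : ParamIndex G i0 → ℝ) : ∃ η : (∀ γ, I γ) → ℝ,
    (∀ t : ParamIndex G i0, η t.toCell = θ t) ∧
    (∀ c, (supp i0 c).Nonempty → ¬ G.IsClique (supp i0 c : Set V) → η c = 0) ∧
    (fun i => Real.log (cellProb G i0 θ i)) = fun i => ∑ c, η c * ind (supp i0 c) c i := by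
  classical
  set κ := Real.log (∑ j, weight G i0 θ j)
  -- The normalizing constant becomes the coefficient of `i0`, whose indicator is identically one.
  set η : (∀ γ, I γ) → ℝ := Function.extend ParamIndex.toCell θ
    (fun c => if c = i0 then -κ else 0) with hη
  have h1 : ∀ t : ParamIndex G i0, η t.toCell = θ t := fun t =>
    ParamIndex.toCell_injective.extend_apply _ _ t
  have h0 : η i0 = -κ := by
    rw [hη, Function.extend_apply' _ _ _ (fun ⟨t, ht⟩ => t.toCell_ne ht), if_pos rfl]
  have h2 : ∀ c, (supp i0 c).Nonempty → ¬ G.IsClique (supp i0 c : Set V) → η c = 0 := by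
    intro c hc hc'
    rw [hη, Function.extend_apply', if_neg]
    · rintro rfl
      simp at hc
    · rintro ⟨t, rfl⟩
      exact hc' (t.supp_toCell ▸ t.isClique_set)
  refine ⟨η, h1, h2, funext fun i => ?_⟩
  rw [sum_eq_add_sum_toCell (G := G) fun c hc hc' => by rw [h2 c hc hc', zero_mul], h0,
    log_cellProb]
  simp only [h1, supp_self, ind_empty, stat]
  ring

lemma cellProb_mem_model (θ : ParamIndex G i0 → ℝ) : cellProb G i0 θ ∈ model G i0 := by
  refine ⟨cellProb_pos θ, sum_cellProb θ, fun E hE hE' x => ?_⟩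
  obtain ⟨η, -, h2, h3⟩ := exists_log_cellProb_eq θ
  rw [logLinear_eq_mob, h3, mob_sum_mul_ind]
  refine h2 _ ?_ ?_ <;> rwa [supp_extend]

lemma thetaD_cellProb (θ : ParamIndex G i0 → ℝ) : thetaD G i0 (cellProb G i0 θ) = θ := by
  funext t
  obtain ⟨η, h1, -, h3⟩ := exists_log_cellProb_eq θ
  refine (logLinear_eq_mob i0 _ t.2).trans ?_
  rw [h3, mob_sum_mul_ind]
  exact h1 t

lemma cellProb_thetaD {p : (∀ γ, I γ) → ℝ} (hp : p ∈ model G i0) :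
    cellProb G i0 (thetaD G i0 p) = p := by
  obtain ⟨hpos, hsum, hlin⟩ := hp
  set η := mob i0 fun i => Real.log (p i) with hη
  have hθ : ∀ t : ParamIndex G i0, thetaD G i0 p t = η t.toCell := fun t =>
    logLinear_eq_mob i0 p t.2
  have h2 : ∀ c, (supp i0 c).Nonempty → ¬ G.IsClique (supp i0 c : Set V) → η c = 0 := by
    intro c hc hc'
    set x : StarCell i0 (supp i0 c) := ⟨fun γ => c γ, fun γ => (mem_supp i0).1 γ.2⟩
    have := (logLinear_eq_mob i0 p x).symm.trans (hlin _ hc hc' x)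
    have hcc : extend i0 x.1 = c := by
      funext γ
      by_cases h : γ ∈ supp i0 c
      · exact dif_pos h
      · rw [eq_of_notMem_supp i0 h]
        exact dif_neg h
    rwa [hcc] at this
  -- The weights omit only the constant term `η i0` of `log p`, so they are proportional to `p`, and
  -- normalizing returns `p`.
  have hw : ∀ i, weight G i0 (thetaD G i0 p) i = p i * Real.exp (-η i0) := by
    intro i
    have h := sum_mob_mul_ind i0 (fun i => Real.log (p i)) i
    rw [← hη, sum_eq_add_sum_toCell (G := G) fun c hc hc' => by rw [h2 c hc hc', zero_mul]] at h
    simp only [supp_self, ind_empty, mul_one] at h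
    rw [weight_eq]
    simp only [hθ, stat]
    rw [← Real.exp_log (hpos i), ← Real.exp_add, ← h]
    congr 1
    ring
  funext i
  simp only [cellProb, hw]
  rw [← sum_mul, hsum, one_mul, mul_div_assoc, div_self (Real.exp_pos _).ne', mul_one]

end Model

/-! ### From local to global smooth inverses -/

section InverseFunction

/-- An injective smooth map with everywhere invertible derivative has open range and a smooth
inverse. -/
theorem exists_contDiffOn_leftInverse {E : Type*} [NormedAddCommGroup E] [NormedSpace ℝ E]
    [FiniteDimensional ℝ E] {f : E → E} (hf : ContDiff ℝ ∞ f) (hinj : Function.Injective f)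
    (hdet : ∀ x, (fderiv ℝ f x).det ≠ 0) :
    IsOpen (Set.range f) ∧ ∃ Ψ : E → E, Function.LeftInverse Ψ f ∧
      ContDiffOn ℝ ∞ Ψ (Set.range f) ∧
      ∀ x, (fderiv ℝ Ψ (f x)).det * (fderiv ℝ f x).det = 1 := by
  have : CompleteSpace E := FiniteDimensional.complete ℝ E
  have hn : (∞ : WithTop ℕ∞) ≠ 0 := by simp
  set e : E → (E ≃L[ℝ] E) := fun x =>
    (fderiv ℝ f x).toContinuousLinearEquivOfDetNeZero (hdet x) with he
  have hd : ∀ x, HasFDerivAt f ((e x : E ≃L[ℝ] E) : E →L[ℝ] E) x := fun x =>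
    (hf.differentiable hn x).hasFDerivAt
  have hs : ∀ x, HasStrictFDerivAt f ((e x : E ≃L[ℝ] E) : E →L[ℝ] E) x := fun x =>
    hf.contDiffAt.hasStrictFDerivAt' (hd x) hn
  have hopen : IsOpenMap f := isOpenMap_of_hasStrictFDerivAt_equiv hs
  have hleft := Function.leftInverse_invFun hinj
  have hsm : ∀ x, ContDiffAt ℝ ∞ (Function.invFun f) (f x) := by
    intro x
    -- By injectivity the global inverse coincides near `f x` with the local inverse, and so
    -- inherits its smoothness.
    refine (hf.contDiffAt.to_localInverse (hd x) hn).congr_of_eventuallyEq ?_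
    filter_upwards [(hs x).eventually_right_inverse] with y hy
    have := hleft ((hs x).localInverse f (e x) x y)
    rwa [hy] at this
  refine ⟨hopen.isOpen_range, Function.invFun f, hleft, ?_, fun x => ?_⟩
  · rintro _ ⟨x, rfl⟩
    exact (hsm x).contDiffWithinAt
  · have h1 := ((hsm x).differentiableAt hn).hasFDerivAt.comp x (hf.differentiable hn x).hasFDerivAt
    rw [hleft.comp_eq_id] at h1
    have h2 := h1.unique (hasFDerivAt_id x)
    rw [ContinuousLinearMap.det, ContinuousLinearMap.det, ← LinearMap.det_comp,
      ← ContinuousLinearMap.toLinearMap_comp, h2]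
    exact LinearMap.det_id

end InverseFunction

/-! ### Mean parameters, covariance and the linear passage to `p^G` -/

section Mean

variable {V : Type*} [Fintype V] [DecidableEq V]
variable {I : V → Type*} [∀ γ, DecidableEq (I γ)] [∀ γ, Fintype (I γ)] {i0 : ∀ γ, I γ}
variable {G : SimpleGraph V}

noncomputable instance : DecidableEq (ParamIndex G i0) := Classical.decEq _

lemma marginal_restrict (p : (∀ γ, I γ) → ℝ) (A : Finset V) (c : ∀ γ, I γ) :
    marginal p A (A.restrict c) = ∑ i, p i * ind A c i := by
  simp only [marginal, ind, mul_ite, mul_one, mul_zero]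
  rw [← sum_filter]
  congr 1
  ext i
  simp [funext_iff]

lemma marginalAt_eq (p : (∀ γ, I γ) → ℝ) (A : Finset V) (t : ParamIndex G i0) :
    marginalAt p A t = ∑ i, p i * ind A t.toCell i := marginal_restrict p A _

/-- The mean parameters `p(i_D)`, `D ∈ 𝒟`, `i_D ∈ I_D^*`. -/
noncomputable def mean (θ : ParamIndex G i0 → ℝ) (t : ParamIndex G i0) : ℝ :=
  ∑ i, cellProb G i0 θ i * stat t i

/-- The covariance matrix of the sufficient statistics. -/
noncomputable def cov (θ : ParamIndex G i0 → ℝ) : Matrix (ParamIndex G i0) (ParamIndex G i0) ℝ :=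
  fun s t => ∑ i, cellProb G i0 θ i * (stat s i * stat t i) - mean θ s * mean θ t

/-- The linear form `θ ↦ ∑_t θ_t stat t i`. -/
noncomputable def statForm (i : ∀ γ, I γ) : (ParamIndex G i0 → ℝ) →L[ℝ] ℝ :=
  ∑ t : ParamIndex G i0, stat t i • ContinuousLinearMap.proj t

lemma statForm_apply (i : ∀ γ, I γ) (v : ParamIndex G i0 → ℝ) :
    statForm i v = ∑ t, v t * stat t i := by
  simp [statForm, mul_comm]

lemma weight_eq_exp (θ : ParamIndex G i0 → ℝ) (i : ∀ γ, I γ) :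
    weight G i0 θ i = Real.exp (statForm i θ) := by rw [weight_eq, statForm_apply]

lemma hasFDerivAt_weight (θ : ParamIndex G i0 → ℝ) (i : ∀ γ, I γ) :
    HasFDerivAt (fun θ : ParamIndex G i0 → ℝ => weight G i0 θ i)
      (weight G i0 θ i • (statForm i : (ParamIndex G i0 → ℝ) →L[ℝ] ℝ)) θ := by
  simp only [weight_eq_exp]
  exact (statForm i).hasFDerivAt.exp

lemma hasFDerivAt_cellProb (θ : ParamIndex G i0 → ℝ) (i : ∀ γ, I γ) :
    HasFDerivAt (fun θ : ParamIndex G i0 → ℝ => cellProb G i0 θ i)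
      (cellProb G i0 θ i • ((statForm i : (ParamIndex G i0 → ℝ) →L[ℝ] ℝ) -
        ∑ j, cellProb G i0 θ j • statForm j)) θ := by
  have h0 := (sum_weight_pos θ).ne'
  -- In exponential form, the logarithmic derivative is the statistic minus its mean, the mean being
  -- the gradient of the log-partition function.
  have h1 : (fun θ : ParamIndex G i0 → ℝ => cellProb G i0 θ i) =
      fun θ => Real.exp (statForm i θ - Real.log (∑ j, weight G i0 θ j)) := by
    funext θ
    rw [← Real.exp_log (cellProb_pos θ i), log_cellProb, statForm_apply]
  have h2 := ((statForm i).hasFDerivAt.sub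
    ((HasFDerivAt.fun_sum fun j _ => hasFDerivAt_weight θ j : HasFDerivAt
      (fun θ : ParamIndex G i0 → ℝ => ∑ j, weight G i0 θ j) _ θ).log h0)).exp
  have h3 : cellProb G i0 θ i = Real.exp (statForm i θ - Real.log (∑ j, weight G i0 θ j)) :=
    congrFun h1 θ
  have h4 : (∑ j, weight G i0 θ j)⁻¹ • ∑ j, weight G i0 θ j • statForm j =
      ∑ j, cellProb G i0 θ j • (statForm j : (ParamIndex G i0 → ℝ) →L[ℝ] ℝ) := by
    rw [smul_sum]
    exact sum_congr rfl fun j _ => by rw [smul_smul, cellProb, div_eq_inv_mul]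
  rw [h4] at h2
  rw [h1, h3]
  exact h2

lemma hasFDerivAt_mean (θ : ParamIndex G i0 → ℝ) :
    HasFDerivAt (mean : (ParamIndex G i0 → ℝ) → _)
      (LinearMap.toContinuousLinearMap (Matrix.toLin' (cov θ))) θ := by
  rw [hasFDerivAt_pi']
  intro s
  have h := HasFDerivAt.fun_sum (u := univ) fun i _ =>
    (hasFDerivAt_cellProb (G := G) θ i).mul_const (stat s i)
  refine h.congr_fderiv ?_
  ext v
  simp only [_root_.sum_apply, _root_.smul_apply,
    _root_.sub_apply, statForm_apply, smul_eq_mul, ContinuousLinearMap.comp_apply,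
    LinearMap.coe_toContinuousLinearMap', Matrix.toLin'_apply, ContinuousLinearMap.proj_apply,
    Matrix.mulVec, dotProduct, cov]
  have hm : ∑ j, cellProb G i0 θ j * ∑ t, v t * stat t j = ∑ t, v t * mean θ t := by
    simp only [mean, mul_sum]
    rw [sum_comm]
    exact sum_congr rfl fun t _ => sum_congr rfl fun i _ => by ring
  rw [hm]
  simp only [sub_mul, mul_sub, sum_sub_distrib]
  congr 1
  · simp only [mul_sum, sum_mul]
    rw [sum_comm]
    exact sum_congr rfl fun t _ => sum_congr rfl fun i _ => by ring
  · have : ∑ t, mean θ s * mean θ t * v t = mean θ s * ∑ t, v t * mean θ t := by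
      rw [mul_sum]
      exact sum_congr rfl fun t _ => by ring
    rw [this, mean, sum_mul]
    exact sum_congr rfl fun i _ => by ring

lemma contDiff_cellProb (i : ∀ γ, I γ) :
    ContDiff ℝ ∞ (fun θ : ParamIndex G i0 → ℝ => cellProb G i0 θ i) := by
  have hw : ∀ j : ∀ γ, I γ, ContDiff ℝ ∞ (fun θ : ParamIndex G i0 → ℝ => weight G i0 θ j) := by
    intro j
    simp only [weight_eq_exp]
    exact (statForm j).contDiff.exp
  exact (hw i).div (ContDiff.sum fun j _ => hw j) fun θ => (sum_weight_pos θ).ne'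

lemma contDiff_changeOfVar (A : Finset V → Finset V) : ContDiff ℝ ∞ (changeOfVar G i0 A) := by
  rw [contDiff_pi]
  intro t
  simp only [changeOfVar, pG, marginalAt_eq]
  exact ContDiff.sum fun i _ => (contDiff_cellProb i).mul contDiff_const

/-- The marginal probabilities `p^G` are a unitriangular linear function of the mean parameters. -/
lemma exists_changeOfVar_eq_mulVec {A : Finset V → Finset V}
    (hA : ∀ D : Finset V, D.Nonempty → G.IsClique (D : Set V) →
      D ⊆ A D ∧ G.IsClique (A D : Set V)) :
    ∃ U : Matrix (ParamIndex G i0) (ParamIndex G i0) ℝ, U.det = 1 ∧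
      ∀ θ, changeOfVar G i0 A θ = U.mulVec (mean θ) := by
  have hA' := fun s : ParamIndex G i0 => hA s.set s.set_nonempty s.isClique_set
  choose u hu1 hu2 hu3 using fun s : ParamIndex G i0 =>
    exists_ind_eq i0 (A s.set) s.toCell (s.supp_toCell ▸ (hA' s).1)
  refine ⟨fun s t => u s t.toCell, ?_, fun θ => ?_⟩
  · refine det_eq_one_of_graded _ (fun t => (supp i0 t.toCell).card) (fun s => hu1 s) ?_
    intro s t h
    rcases (hu2 s _ h).2 with h' | h'
    · exact Or.inl (ParamIndex.toCell_injective h').symm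
    · exact Or.inr h'
  · funext s
    -- No constant term occurs: the cells used are `s.toCell` and cells with larger support, so the
    -- map is linear and not merely affine.
    have h0 : u s i0 = 0 := by
      by_contra h
      rcases (hu2 s _ h).2 with h' | h'
      · exact s.toCell_ne h'.symm
      · simp at h'
    have h1 : ∀ i, ind (A s.set) s.toCell i = ∑ t : ParamIndex G i0, u s t.toCell * stat t i := by
      intro i
      rw [hu3 s i, sum_eq_add_sum_toCell (G := G), h0, zero_mul, zero_add]
      · rfl
      -- Completeness of the block enters here: every cell supported in it has complete support.
      · intro c _ hc
        have : u s c = 0 := by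
          by_contra h
          exact hc ((hA' s).2.subset (coe_subset.2 (hu2 s c h).1))
        rw [this, zero_mul]
    simp only [changeOfVar, pG, marginalAt_eq, h1, Matrix.mulVec, dotProduct, mean, mul_sum]
    rw [sum_comm]
    exact sum_congr rfl fun t _ => sum_congr rfl fun i _ => by ring

/-- The sum of `(p - q) * (log p - log q)` pairs the difference of the parameters with the
difference of the means, so it vanishes when the means agree. Each summand is nonnegative because
`log` is increasing; hence `p = q`, and the parameters are recovered from `p`. -/
lemma mean_injective : Function.Injective (mean : (ParamIndex G i0 → ℝ) → _) := by
  intro θ θ' h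
  set p := cellProb G i0 θ with hp
  set q := cellProb G i0 θ' with hq
  have hnn : ∀ i, 0 ≤ (p i - q i) * (Real.log (p i) - Real.log (q i)) := by
    intro i
    rcases le_total (p i) (q i) with hle | hle
    · exact mul_nonneg_of_nonpos_of_nonpos (sub_nonpos.2 hle)
        (sub_nonpos.2 (Real.log_le_log (cellProb_pos θ i) hle))
    · exact mul_nonneg (sub_nonneg.2 hle)
        (sub_nonneg.2 (Real.log_le_log (cellProb_pos θ' i) hle))
  have hz : ∑ i, (p i - q i) * (Real.log (p i) - Real.log (q i)) = 0 := by
    set κ := Real.log (∑ j, weight G i0 θ' j) - Real.log (∑ j, weight G i0 θ j)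
    have h1 : ∀ i, (p i - q i) * (Real.log (p i) - Real.log (q i)) =
        ∑ t, (θ t - θ' t) * (p i * stat t i - q i * stat t i) + (p i - q i) * κ := by
      intro i
      rw [hp, hq, log_cellProb, log_cellProb, ← hp, ← hq]
      have : ∑ t, (θ t - θ' t) * (p i * stat t i - q i * stat t i) =
          (p i - q i) * (∑ t, θ t * stat t i - ∑ t, θ' t * stat t i) := by
        rw [← sum_sub_distrib, mul_sum]
        exact sum_congr rfl fun t _ => by ring
      rw [this]
      ring
    have h2 : ∀ t : ParamIndex G i0, ∑ i, (p i * stat t i - q i * stat t i) = 0 := by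
      intro t
      rw [sum_sub_distrib]
      exact sub_eq_zero.2 (congrFun h t)
    rw [sum_congr rfl fun i _ => h1 i, sum_add_distrib, ← sum_mul, sum_sub_distrib, hp, hq,
      sum_cellProb, sum_cellProb, sum_comm, ← hp, ← hq]
    simp only [← mul_sum, h2]
    simp
  have hpq : p = q := by
    funext i
    have := (sum_eq_zero_iff_of_nonneg fun i _ => hnn i).1 hz i (mem_univ i)
    rcases mul_eq_zero.1 this with h' | h'
    · exact sub_eq_zero.1 h'
    · exact Real.log_injOn_pos (cellProb_pos θ i) (cellProb_pos θ' i) (sub_eq_zero.1 h')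
  rw [← thetaD_cellProb θ, ← thetaD_cellProb θ', ← hp, ← hq, hpq]

/-- The covariance determinant is the determinant of the second moment matrix bordered by the
constant statistic. -/
lemma det_cov (θ : ParamIndex G i0 → ℝ) {J : Finset (∀ γ, I γ)}
    (hJ : ∀ c, c ∈ J ↔ G.IsClique (supp i0 c : Set V)) :
    (cov θ).det = gramDet i0 (cellProb G i0 θ) J := by
  set K : Finset (∀ γ, I γ) := univ.image (ParamIndex.toCell : ParamIndex G i0 → _) with hK
  have hJK : J = {i0} ∪ K := by
    ext c
    rw [hJ, mem_union, mem_singleton, hK, mem_image]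
    constructor
    · intro h
      by_cases hc : c = i0
      · exact Or.inl hc
      · have h1 : (supp i0 c).Nonempty := by
          rwa [nonempty_iff_ne_empty, Ne, supp_eq_empty]
        obtain ⟨t, ht⟩ := ParamIndex.exists_toCell_eq h1 h
        exact Or.inr ⟨t, mem_univ _, ht⟩
    · rintro (rfl | ⟨t, -, rfl⟩)
      · simp
      · rw [t.supp_toCell]
        exact t.isClique_set
  have hdis : Disjoint {i0} K := by
    rw [disjoint_singleton_left]
    intro h
    obtain ⟨t, -, ht⟩ := mem_image.1 h
    exact t.toCell_ne ht
  have h00 : gram i0 (cellProb G i0 θ) i0 i0 = 1 := by simp [gram, sum_cellProb]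
  -- Schur complement with respect to the constant statistic, whose own moment is one: subtracting
  -- the products of means leaves the covariances.
  have key := det_submatrix_union (gram i0 (cellProb G i0 θ))
    (fun _ t => ∑ i, cellProb G i0 θ i * ind (supp i0 t) t i) (S := {i0}) subset_rfl hdis
    (by
      intro s hs t _
      rw [mem_singleton] at hs
      subst hs
      rw [sum_singleton, h00, one_mul]
      simp [gram])
  have h1 : ((gram i0 (cellProb G i0 θ)).submatrix
      (Subtype.val : ({i0} : Finset (∀ γ, I γ)) → _) Subtype.val).det = 1 := by
    rw [Matrix.det_unique]
    exact h00
  rw [hJK, gramDet, key, h1, one_mul]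
  let e : ParamIndex G i0 ≃ K := Equiv.ofBijective (fun t => ⟨t.toCell, mem_image_of_mem _
    (mem_univ t)⟩) ⟨fun s t h => ParamIndex.toCell_injective (Subtype.ext_iff.1 h), by
      rintro ⟨c, hc⟩
      obtain ⟨t, -, ht⟩ := mem_image.1 hc
      exact ⟨t, Subtype.ext ht⟩⟩
  rw [← Matrix.det_submatrix_equiv_self e]
  congr 1
  ext s t
  simp only [Matrix.submatrix_apply, Matrix.of_apply, sum_singleton]
  change cov θ s t = gram i0 (cellProb G i0 θ) s.toCell t.toCell -
    gram i0 (cellProb G i0 θ) s.toCell i0 * _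
  have : gram i0 (cellProb G i0 θ) s.toCell i0 = mean θ s := by simp [gram, mean, stat]
  rw [this]
  rfl

/-- In a complete `A` every nonempty subset is an admissible `D`, so the factors of `blockProd`
account for each cell of the `A`-marginal table once. -/
lemma blockProd_eq_cellProd (p : (∀ γ, I γ) → ℝ) {A : Finset V} (hA : G.IsClique (A : Set V)) :
    blockProd G i0 p A = cellProd i0 p A := by
  classical
  have h : cellsIn i0 A = insert i0 ((univ.filter fun t : ParamIndex G i0 => t.set ⊆ A).image
      ParamIndex.toCell) := by
    ext c
    simp only [mem_cellsIn, mem_insert, mem_image, mem_filter, mem_univ, true_and]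
    constructor
    · intro h
      by_cases hc : c = i0
      · exact Or.inl hc
      · have h1 : (supp i0 c).Nonempty := by
          rwa [nonempty_iff_ne_empty, Ne, supp_eq_empty]
        obtain ⟨t, rfl⟩ := ParamIndex.exists_toCell_eq h1 (hA.subset (coe_subset.2 h))
        exact Or.inr ⟨t, t.supp_toCell ▸ h, rfl⟩
    · rintro (rfl | ⟨t, ht, rfl⟩)
      · simp
      · rwa [t.supp_toCell]
  rw [cellProd, h, prod_insert, prod_image ParamIndex.toCell_injective.injOn, blockProd,
    marginal_restrict]
  · simp only [marginalAt_eq]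
  · intro h
    obtain ⟨t, -, ht⟩ := mem_image.1 h
    exact t.toCell_ne ht

end Mean

/-! ### Factorization over the cliques and the Jacobian -/

section Jacobian

variable {V : Type*} [Fintype V] [DecidableEq V]
variable {I : V → Type*} [∀ γ, DecidableEq (I γ)] [∀ γ, Fintype (I γ)] {i0 : ∀ γ, I γ}
variable {G : SimpleGraph V} {m : ℕ} {C : Fin (m + 1) → Finset V}

/-- The extension of a finite sequence of vertex sets by empty sets. -/
def seqExt (C : Fin (m + 1) → Finset V) (j : ℕ) : Finset V :=
  if h : j < m + 1 then C ⟨j, h⟩ else ∅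

lemma seqExt_val (C : Fin (m + 1) → Finset V) (l : Fin (m + 1)) : seqExt C l = C l :=
  dif_pos l.2

lemma sep_seqExt (C : Fin (m + 1) → Finset V) (l : Fin m) :
    sep (seqExt C) (l + 1) = separator C l := by
  unfold sep separator
  rw [← seqExt_val C l.succ, Fin.val_succ]
  congr 1
  ext γ
  simp only [mem_biUnion, mem_range, mem_filter, mem_univ, true_and]
  constructor
  · rintro ⟨j, hj, h⟩
    have hj' : j < m + 1 := by omega
    refine ⟨⟨j, hj'⟩, ?_, by rwa [← seqExt_val C ⟨j, hj'⟩]⟩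
    rw [Fin.le_def]
    simp only [Fin.val_castSucc]
    omega
  · rintro ⟨j, hj, h⟩
    rw [Fin.le_def] at hj
    simp only [Fin.val_castSucc] at hj
    exact ⟨j, by omega, by rwa [seqExt_val]⟩

lemma IsPerfectCliqueSequence.isClique (hC : IsPerfectCliqueSequence G C) (l : Fin (m + 1)) :
    G.IsClique (C l : Set V) := ((hC.mem_range_iff _).1 ⟨l, rfl⟩).prop

lemma IsPerfectCliqueSequence.isClique_separator (hC : IsPerfectCliqueSequence G C) (l : Fin m) :
    G.IsClique (separator C l : Set V) :=
  (hC.isClique l.succ).subset (coe_subset.2 inter_subset_left)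

lemma IsPerfectCliqueSequence.exists_subset (hC : IsPerfectCliqueSequence G C) {D : Finset V}
    (hD : G.IsClique (D : Set V)) : ∃ l, D ⊆ C l := by
  obtain ⟨K, hDK, hK⟩ := (Set.toFinite {L : Finset V | G.IsClique (L : Set V)}).exists_le_maximal hD
  obtain ⟨l, rfl⟩ := (hC.mem_range_iff K).2 hK
  exact ⟨l, hDK⟩

lemma IsBlockChoice.isClique {A : Finset V → Finset V} (hA : IsBlockChoice G C A)
    (hC : IsPerfectCliqueSequence G C) {D : Finset V} (h1 : D.Nonempty)
    (h2 : G.IsClique (D : Set V)) : G.IsClique (A D : Set V) := by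
  obtain ⟨-, h3, h4⟩ := hA D h1 h2
  by_cases h : ∃ l, D ⊆ separator C l
  · obtain ⟨l, hl⟩ := h3 h
    exact hl ▸ hC.isClique_separator l
  · obtain ⟨l, hl⟩ := h4 h
    exact hl ▸ hC.isClique l

lemma cellProd_pos {p : (∀ γ, I γ) → ℝ} (hp : ∀ i, 0 < p i) (A : Finset V) :
    0 < cellProd i0 p A := by
  refine prod_pos fun c _ => sum_pos' (fun i _ => ?_) ⟨c, mem_univ _, ?_⟩
  · unfold ind
    split_ifs
    · simpa using (hp i).le
    · simp
  · simpa [ind_self] using hp c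

/-- The cell probabilities of the model factorize over the cliques. -/
lemma exists_cellProb_eq_prod (hC : IsPerfectCliqueSequence G C) (θ : ParamIndex G i0 → ℝ) :
    ∃ ψ : ℕ → (∀ γ, I γ) → ℝ, (∀ j i, 0 < ψ j i) ∧
      (∀ j, DependsOn (ψ j) (seqExt C j : Set V)) ∧
      cellProb G i0 θ = fun i => ∏ j ∈ range (m + 1), ψ j i := by
  choose k hk using fun t : ParamIndex G i0 => hC.exists_subset t.isClique_set
  set Z := ∑ j, weight G i0 θ j with hZ
  have hZ0 : 0 < Z := sum_weight_pos θ
  -- Each interaction term is assigned to one clique `k t` containing it, and the normalizing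
  -- constant goes to the factor with index `0`.
  refine ⟨fun j i => (if j = 0 then Z⁻¹ else 1) *
    Real.exp (∑ t with (k t : ℕ) = j, θ t * stat t i), fun j i => ?_, fun j i i' h => ?_, ?_⟩
  · refine mul_pos ?_ (Real.exp_pos _)
    split_ifs
    · exact inv_pos.2 hZ0
    · exact one_pos
  · simp only
    congr 2
    refine sum_congr rfl fun t ht => ?_
    congr 1
    refine ind_congr _ fun γ hγ => h γ ?_
    rw [← (mem_filter.1 ht).2, seqExt_val]
    rw [t.supp_toCell] at hγ
    exact hk t hγ
  · funext i
    rw [prod_mul_distrib, ← Real.exp_sum, prod_ite_eq' (range (m + 1)) 0 (fun _ => Z⁻¹),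
      if_pos (mem_range.2 (Nat.succ_pos m)), sum_fiberwise_of_maps_to (fun t _ => mem_range.2 (k t).2),
      cellProb, weight_eq, div_eq_inv_mul]

/-- The determinant of the covariance matrix of the sufficient statistics. -/
theorem det_cov_eq_jacobianRatio (hC : IsPerfectCliqueSequence G C) (θ : ParamIndex G i0 → ℝ) :
    (cov θ).det = jacobianRatio G i0 C (cellProb G i0 θ) := by
  obtain ⟨ψ, hpos, hdep, hψ⟩ := exists_cellProb_eq_prod hC θ
  have key := gramDet_cellsUpTo i0 (seqExt C) m (fun l hl => by
      obtain ⟨j, hj, h⟩ := hC.running_intersection ⟨l, hl⟩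
      refine ⟨j, by simpa [Fin.le_def] using hj, ?_⟩
      rw [seqExt_val]
      exact (sep_seqExt C ⟨l, hl⟩).subset.trans h) ψ hpos hdep
  rw [← hψ, ← Fin.prod_univ_eq_prod_range (fun l => cellProd i0 _ (sep (seqExt C) (l + 1))),
    ← Fin.prod_univ_eq_prod_range (fun l => cellProd i0 _ (seqExt C l)),
    ← det_cov (G := G)] at key
  · simp only [sep_seqExt, seqExt_val] at key
    rw [jacobianRatio, eq_div_iff]
    · simpa only [blockProd_eq_cellProd _ (hC.isClique _),
        blockProd_eq_cellProd _ (hC.isClique_separator _)] using key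
    · refine prod_ne_zero_iff.2 fun l _ => ?_
      rw [blockProd_eq_cellProd _ (hC.isClique_separator l)]
      exact (cellProd_pos (cellProb_pos θ) _).ne'
  -- The cliques together carry exactly the cells with complete support, the index set required by
  -- `det_cov`.
  · intro c
    rw [mem_cellsUpTo]
    constructor
    · rintro ⟨j, hj, h⟩
      rw [seqExt, dif_pos hj] at h
      exact (hC.isClique _).subset (coe_subset.2 h)
    · intro h
      obtain ⟨l, hl⟩ := hC.exists_subset h
      exact ⟨l, l.2, by rwa [seqExt_val]⟩

lemma jacobianRatio_pos (hC : IsPerfectCliqueSequence G C) {p : (∀ γ, I γ) → ℝ}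
    (hp : ∀ i, 0 < p i) : 0 < jacobianRatio G i0 C p := by
  refine div_pos (prod_pos fun l _ => ?_) (prod_pos fun l _ => ?_)
  · rw [blockProd_eq_cellProd _ (hC.isClique l)]
    exact cellProd_pos hp _
  · rw [blockProd_eq_cellProd _ (hC.isClique_separator l)]
    exact cellProd_pos hp _

lemma changeOfVar_injective {A : Finset V → Finset V}
    (hA : ∀ D : Finset V, D.Nonempty → G.IsClique (D : Set V) →
      D ⊆ A D ∧ G.IsClique (A D : Set V)) : Function.Injective (changeOfVar G i0 A) := by
  obtain ⟨U, hU, h⟩ := exists_changeOfVar_eq_mulVec (i0 := i0) hA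
  intro θ θ' hθ
  rw [h, h] at hθ
  exact mean_injective (Matrix.mulVec_injective_of_isUnit
    ((Matrix.isUnit_iff_isUnit_det U).2 (hU ▸ isUnit_one)) hθ)

/-- Chain rule: the linear factor `U` is unitriangular, so only the covariance determinant remains.
-/
lemma det_fderiv_changeOfVar {A : Finset V → Finset V}
    (hA : ∀ D : Finset V, D.Nonempty → G.IsClique (D : Set V) →
      D ⊆ A D ∧ G.IsClique (A D : Set V)) (θ : ParamIndex G i0 → ℝ) :
    (fderiv ℝ (changeOfVar G i0 A) θ).det = (cov θ).det := by
  obtain ⟨U, hU, h⟩ := exists_changeOfVar_eq_mulVec (i0 := i0) hA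
  have h1 : HasFDerivAt (changeOfVar G i0 A)
      ((LinearMap.toContinuousLinearMap (Matrix.toLin' U)).comp
        (LinearMap.toContinuousLinearMap (Matrix.toLin' (cov θ)))) θ := by
    have : changeOfVar G i0 A = LinearMap.toContinuousLinearMap (Matrix.toLin' U) ∘ mean := by
      funext θ
      rw [h]
      rfl
    rw [this]
    exact (ContinuousLinearMap.hasFDerivAt _).comp θ (hasFDerivAt_mean θ)
  rw [h1.fderiv, ContinuousLinearMap.det, ContinuousLinearMap.toLinearMap_comp, LinearMap.det_comp]
  simp [LinearMap.det_toLin', hU]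

end Jacobian

end LogLinear

theorem lemma4p1 {V : Type*} [Fintype V] [DecidableEq V] (G : SimpleGraph V)
    {I : V → Type*} [∀ γ, Fintype (I γ)] [∀ γ, DecidableEq (I γ)] (i0 : ∀ γ, I γ)
    {m : ℕ} (C : Fin (m + 1) → Finset V) (hC : LogLinear.IsPerfectCliqueSequence G C)
    (A : Finset V → Finset V) (hA : LogLinear.IsBlockChoice G C A) :
    -- `θ_𝒟` is a coordinate system of the model, with inverse `θ ↦ cellProb θ`
    (∀ θ : LogLinear.ParamIndex G i0 → ℝ,
      LogLinear.cellProb G i0 θ ∈ LogLinear.model G i0 ∧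
        LogLinear.thetaD G i0 (LogLinear.cellProb G i0 θ) = θ) ∧
    (∀ p ∈ LogLinear.model G i0, LogLinear.cellProb G i0 (LogLinear.thetaD G i0 p) = p) ∧
    -- `θ_𝒟 ↦ p^G` is a smooth change of variables, with the stated Jacobian
    ContDiff ℝ ∞ (LogLinear.changeOfVar G i0 A) ∧
    IsOpen (Set.range (LogLinear.changeOfVar G i0 A)) ∧
    ∃ Ψ : (LogLinear.ParamIndex G i0 → ℝ) → (LogLinear.ParamIndex G i0 → ℝ),
      Function.LeftInverse Ψ (LogLinear.changeOfVar G i0 A) ∧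
      ContDiffOn ℝ ∞ Ψ (Set.range (LogLinear.changeOfVar G i0 A)) ∧
      ∀ θ : LogLinear.ParamIndex G i0 → ℝ,
        |(fderiv ℝ Ψ (LogLinear.changeOfVar G i0 A θ)).det|⁻¹ =
            LogLinear.jacobianRatio G i0 C (LogLinear.cellProb G i0 θ) ∧
        |(fderiv ℝ (LogLinear.changeOfVar G i0 A) θ).det| =
            LogLinear.jacobianRatio G i0 C (LogLinear.cellProb G i0 θ) := by
  have hA' : ∀ D : Finset V, D.Nonempty → G.IsClique (D : Set V) →
      D ⊆ A D ∧ G.IsClique (A D : Set V) := fun D h1 h2 => ⟨(hA D h1 h2).1, hA.isClique hC h1 h2⟩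
  have hpos := fun θ : LogLinear.ParamIndex G i0 → ℝ =>
    LogLinear.jacobianRatio_pos (i0 := i0) hC (LogLinear.cellProb_pos θ)
  have hdet : ∀ θ, (fderiv ℝ (LogLinear.changeOfVar G i0 A) θ).det =
      LogLinear.jacobianRatio G i0 C (LogLinear.cellProb G i0 θ) := fun θ =>
    (LogLinear.det_fderiv_changeOfVar hA' θ).trans (LogLinear.det_cov_eq_jacobianRatio hC θ)
  obtain ⟨hopen, Ψ, hleft, hsmooth, hinv⟩ := LogLinear.exists_contDiffOn_leftInverse
    (LogLinear.contDiff_changeOfVar (i0 := i0) A) (LogLinear.changeOfVar_injective hA')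
    fun θ => (hdet θ).trans_ne (hpos θ).ne'
  refine ⟨fun θ => ⟨LogLinear.cellProb_mem_model θ, LogLinear.thetaD_cellProb θ⟩,
    fun p hp => LogLinear.cellProb_thetaD hp, LogLinear.contDiff_changeOfVar A, hopen, Ψ, hleft,
    hsmooth, fun θ => ?_⟩
  have h := hinv θ
  rw [hdet] at h
  rw [hdet, eq_inv_of_mul_eq_one_left h, abs_inv, inv_inv, abs_of_pos (hpos θ)]
  exact ⟨rfl, rfl⟩
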